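/- Let $\mathcal H$ be a separable infinite-dimensional real Hilbert space, let $B>0$ be a strictly positive bounded operator on $\mathcal H$, and let $\mu_B$ be the centred Gaussian probability measure on $\mathcal H$ with covariance operator $B$, i.e. $\int_{\mathcal H} e^{i\langle x,y\rangle}\,d\mu_B(x)=e^{-\frac12\langle By,y\rangle}$ for all $y\in\mathcal H$ (assumed to exist, so that $B$ is nuclear). Let $\mathcal H_0=B^{1/2}\mathcal H$ with the inner product $\langle x,y\rangle_0=\langle B^{-1/2}x,B^{-1/2}y\rangle$ and norm $\|\cdot\|_0$. For $h\in\mathcal H_0$ put $\exp_h(x)=e^{\langle B^{-1}h,x\rangle-\frac12\|h\|_0^2}$, where $h\mapsto\langle B^{-1}h,\cdot\rangle\in L^2(\mathcal H,\mu_B)$ denotes the isometric extension to $\mathcal H_0$ of the map $Bu\mapsto\langle u,\cdot\rangle$, $u\in\mathcal H$. Let $\mathrm{Aff}(\mathcal H_0)=\mathcal H_0\rtimes\mathcal O(\mathcal H_0)$ be the group of affine operators $A=(f,V)$, $Ah=f+Vh$, with $f\in\mathcal H_0$ and $V$ an orthogonal operator. For $A=(f,V)$ define $f^{(n)}$ by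 $A^n=(f^{(n)},V^n)$ and $\alpha_t(A)=(tf,V)$, and let $W_A$ be the unitary Weyl operator on $L^2(\mathcal H,\mu_B)$ with $W_A\exp_h=e^{-\langle f,Vh\rangle_0-\frac12\|f\|_0^2}\exp_{f+Vh}$ for all $h\in\mathcal H_0$. The nonsingular Gaussian transformation $T_A$ is the (unique mod $\mu_B$-null sets) invertible $\mu_B$-nonsingular transformation of $\mathcal H$ whose Koopman operator $U_{T_A}g=g\circ T_A^{-1}\sqrt{d(\mu_B\circ T_A^{-1})/d\mu_B}$ equals $W_{\alpha_{1/2}(A)}$. The Poincaré exponent of $A$ is $$\delta_A=\inf\Big\{\alpha>0\ :\ \sum_{n=1}^\infty e^{-\alpha\|f^{(n)}\|_0^2}<\infty\Big\}\in[0,+\infty].$$ **Proposition 3.14.** Let $A=(f,V)\in\mathrm{Aff}(\mathcal H_0)$ be such that $V$ has no non-zero invariant vectors. Then there is a unique $t_{\mathrm{diss}}(A)\in[0,+\infty]$ such that $T_{\alpha_t(A)}$ is conservative for all real $t$ with $0<t<t_{\mathrm{diss}}(A)$ and totally dissipative for all real $t>t_{\mathrm{diss}}(A)$, and $$\sqrt{2\delta_A}\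 \le\ t_{\mathrm{diss}}(A)\ \le\ 2\sqrt{2\delta_A}.$$ -/

import Mathlib

open MeasureTheory Filter Topology
open scoped ENNReal RealInnerProductSpace

noncomputable section

namespace NonsingularGaussian

/-! ### The square root of a positive operator on a real Hilbert space -/

section SquareRoot

/-- The Taylor coefficients of `(1 - √(1 - x)) / (x / 2)`. -/
def sqrtCoeff (n : ℕ) : ℝ := (catalan n : ℝ) / 4 ^ n

lemma sqrtCoeff_nonneg (n : ℕ) : 0 ≤ sqrtCoeff n := by
  unfold sqrtCoeff; positivity

lemma sqrtCoeff_succ (n : ℕ) :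
    sqrtCoeff (n + 1) =
      (1 / 4) * ∑ ij ∈ Finset.HasAntidiagonal.antidiagonal n, sqrtCoeff ij.1 * sqrtCoeff ij.2 := by
  unfold sqrtCoeff
  rw [catalan_succ', Nat.cast_sum, Finset.sum_div, Finset.mul_sum]
  refine Finset.sum_congr rfl fun ij hij => ?_
  rw [Finset.HasAntidiagonal.mem_antidiagonal] at hij
  rw [← hij]
  push_cast
  field_simp
  ring

lemma sum_sqrtCoeff_le (N : ℕ) : ∑ n ∈ Finset.range N, sqrtCoeff n ≤ 2 := by
  induction N with
  | zero => simp
  | succ N ih =>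
    have h0 : 0 ≤ ∑ n ∈ Finset.range N, sqrtCoeff n :=
      Finset.sum_nonneg fun n _ => sqrtCoeff_nonneg n
    have h1 : ∑ n ∈ Finset.range N,
        ∑ ij ∈ Finset.HasAntidiagonal.antidiagonal n, sqrtCoeff ij.1 * sqrtCoeff ij.2 ≤
        (∑ n ∈ Finset.range N, sqrtCoeff n) * ∑ n ∈ Finset.range N, sqrtCoeff n := by
      rw [Finset.sum_mul_sum, ← Finset.sum_product', ← Finset.sum_biUnion]
      · refine Finset.sum_le_sum_of_subset_of_nonneg (fun p hp => ?_)
          fun p _ _ => mul_nonneg (sqrtCoeff_nonneg _) (sqrtCoeff_nonneg _)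
        simp only [Finset.mem_biUnion, Finset.mem_range, Finset.HasAntidiagonal.mem_antidiagonal] at hp
        obtain ⟨n, hn, h⟩ := hp
        simp only [Finset.mem_product, Finset.mem_range]
        omega
      · intro m _ n _ hmn
        refine Finset.disjoint_left.2 fun p hp hq => hmn ?_
        rw [Finset.HasAntidiagonal.mem_antidiagonal] at hp hq
        omega
    rw [Finset.sum_range_succ']
    simp only [sqrtCoeff_succ, ← Finset.mul_sum]
    have : sqrtCoeff 0 = 1 := by simp [sqrtCoeff]
    rw [this]
    nlinarith

lemma summable_sqrtCoeff : Summable sqrtCoeff :=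
  summable_of_sum_range_le sqrtCoeff_nonneg sum_sqrtCoeff_le

lemma tsum_sqrtCoeff_le : ∑' n, sqrtCoeff n ≤ 2 :=
  Real.tsum_le_of_sum_range_le sqrtCoeff_nonneg sum_sqrtCoeff_le

variable {H : Type*} [NormedAddCommGroup H] [InnerProductSpace ℝ H] [CompleteSpace H]

lemma exists_sqrt_one_sub {A : H →L[ℝ] H} (hA : IsSelfAdjoint A) (hA1 : ‖A‖ ≤ 1) :
    ∃ S : H →L[ℝ] H, S.IsPositive ∧ S ∘L S = 1 - A := by
  have hpow : ∀ n : ℕ, ‖A ^ n‖ ≤ 1 := fun n => by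
    induction n with
    | zero => simpa using! ContinuousLinearMap.norm_id_le (𝕜 := ℝ) (E := H)
    | succ n ih =>
      rw [pow_succ]
      exact (norm_mul_le _ _).trans (mul_le_one₀ ih (norm_nonneg _) hA1)
  set u : ℕ → H →L[ℝ] H := fun n => sqrtCoeff n • A ^ n with hu
  have hun : ∀ n, ‖u n‖ ≤ sqrtCoeff n := fun n => by
    rw [hu]
    simp only [norm_smul, Real.norm_eq_abs, abs_of_nonneg (sqrtCoeff_nonneg n)]
    exact mul_le_of_le_one_right (sqrtCoeff_nonneg n) (hpow n)
  have hsum : Summable fun n => ‖u n‖ :=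
    Summable.of_nonneg_of_le (fun _ => norm_nonneg _) hun summable_sqrtCoeff
  set C := ∑' n, u n with hC
  have hCn : ‖C‖ ≤ 2 :=
    (tsum_of_norm_bounded summable_sqrtCoeff.hasSum hun).trans tsum_sqrtCoeff_le
  have hCsa : IsSelfAdjoint C := by
    rw [isSelfAdjoint_iff, hC, tsum_star]
    refine tsum_congr fun n => ?_
    simp [hu, hA.star_eq]
  have hCA : Commute A C := by
    refine Commute.tsum_right _ fun n => ?_
    exact ((Commute.refl A).pow_right n).smul_right _
  have hCeq : C = 1 + (1 / 4 : ℝ) • (A * (C * C)) := by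
    have h1 : C * C = ∑' n, ∑ kl ∈ Finset.HasAntidiagonal.antidiagonal n, u kl.1 * u kl.2 :=
      tsum_mul_tsum_eq_tsum_sum_antidiagonal_of_summable_norm hsum hsum
    have h2 : ∀ n, u (n + 1) =
        (1 / 4 : ℝ) • (A * ∑ kl ∈ Finset.HasAntidiagonal.antidiagonal n, u kl.1 * u kl.2) := fun n => by
      have : ∑ kl ∈ Finset.HasAntidiagonal.antidiagonal n, u kl.1 * u kl.2 =
          (∑ kl ∈ Finset.HasAntidiagonal.antidiagonal n, sqrtCoeff kl.1 * sqrtCoeff kl.2) • A ^ n := by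
        rw [Finset.sum_smul]
        refine Finset.sum_congr rfl fun kl hkl => ?_
        rw [Finset.HasAntidiagonal.mem_antidiagonal] at hkl
        simp only [hu, smul_mul_smul_comm, ← pow_add, hkl]
      rw [this, mul_smul_comm, smul_smul, ← sqrtCoeff_succ, ← pow_succ']
    have h3 : Summable fun n => ∑ kl ∈ Finset.HasAntidiagonal.antidiagonal n, u kl.1 * u kl.2 :=
      (summable_norm_sum_mul_antidiagonal_of_summable_norm hsum hsum).of_norm
    rw [h1, ← h3.tsum_mul_left, ← tsum_const_smul'']
    simp_rw [← h2]
    rw [hC, hsum.of_norm.tsum_eq_zero_add]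
    simp [hu, sqrtCoeff]
  refine ⟨1 - (1 / 2 : ℝ) • (A * C), ?_, ?_⟩
  · rw [ContinuousLinearMap.isPositive_def']
    refine ⟨?_, fun x => ?_⟩
    · refine (IsSelfAdjoint.one _).sub (IsSelfAdjoint.smul (by simp [IsSelfAdjoint]) ?_)
      exact (IsSelfAdjoint.commute_iff hA hCsa).1 hCA
    · have h1 : ‖(A * C) x‖ ≤ 2 * ‖x‖ := by
        refine (ContinuousLinearMap.le_opNorm _ _).trans ?_
        gcongr
        refine (norm_mul_le _ _).trans ?_
        nlinarith [norm_nonneg A, norm_nonneg C]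
      have h2 := real_inner_le_norm ((A * C) x) x
      have h3 : (1 - (1 / 2 : ℝ) • (A * C)).reApplyInnerSelf x =
          ‖x‖ ^ 2 - (1 / 2) * ⟪(A * C) x, x⟫ := by
        rw [ContinuousLinearMap.reApplyInnerSelf_apply]
        simp [inner_sub_left, real_inner_smul_left]
      rw [h3]
      nlinarith [norm_nonneg x]
  · change (1 - (1 / 2 : ℝ) • (A * C)) * (1 - (1 / 2 : ℝ) • (A * C)) = 1 - A
    have e1 : (A * C) * (A * C) = A * (A * (C * C)) := by
      rw [mul_assoc, ← mul_assoc C A C, ← hCA.eq, mul_assoc]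
    have e2 : (1 / 4 : ℝ) • ((A * C) * (A * C)) = A * C - A := by
      have : (1 / 4 : ℝ) • (A * (C * C)) = C - 1 := by
        rw [eq_sub_iff_add_eq, add_comm]; exact hCeq.symm
      rw [e1, ← mul_smul_comm, this, mul_sub, mul_one]
    rw [mul_sub, sub_mul, sub_mul, smul_mul_smul_comm]
    rw [show (1 / 2 : ℝ) * (1 / 2) = 1 / 4 by norm_num, e2]
    simp only [mul_one, one_mul]
    module

/-- Every positive bounded operator on a real Hilbert space has a positive square root. -/
lemma exists_posSqrt {B : H →L[ℝ] H} (hB : B.IsPositive) :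
    ∃ S : H →L[ℝ] H, S.IsPositive ∧ S ∘L S = B := by
  set c : ℝ := ‖B‖ + 1 with hc
  have hc0 : 0 < c := by positivity
  set A : H →L[ℝ] H := 1 - c⁻¹ • B with hAdef
  have hAsa : IsSelfAdjoint A :=
    (IsSelfAdjoint.one _).sub (IsSelfAdjoint.smul (by simp [IsSelfAdjoint]) hB.isSelfAdjoint)
  have hA1 : ‖A‖ ≤ 1 := by
    rw [ContinuousLinearMap.norm_eq_iSup_rayleighQuotient A hAsa.isSymmetric]
    refine ciSup_le fun x => ?_
    have h1 : A.reApplyInnerSelf x = ‖x‖ ^ 2 - c⁻¹ * ⟪B x, x⟫ := by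
      rw [ContinuousLinearMap.reApplyInnerSelf_apply]
      simp [hAdef, inner_sub_left, real_inner_smul_left]
    have h2 : 0 ≤ ⟪B x, x⟫ := hB.inner_nonneg_left x
    have h3 : c⁻¹ * ⟪B x, x⟫ ≤ ‖x‖ ^ 2 := by
      rw [inv_mul_le_iff₀ hc0]
      have := real_inner_le_norm (B x) x
      have := B.le_opNorm x
      nlinarith [norm_nonneg x, norm_nonneg B]
    have h4 : 0 ≤ c⁻¹ * ⟪B x, x⟫ := by positivity
    rw [ContinuousLinearMap.rayleighQuotient, h1, abs_of_nonneg
      (div_nonneg (by linarith) (by positivity))]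
    exact div_le_one_of_le₀ (by linarith) (by positivity)
  obtain ⟨S, hS, hSS⟩ := exists_sqrt_one_sub hAsa hA1
  refine ⟨√c • S, hS.smul_of_nonneg (Real.sqrt_nonneg c), ?_⟩
  have : (√c • S) ∘L (√c • S) = c • (S ∘L S) := by
    ext x
    simp [smul_smul, Real.mul_self_sqrt hc0.le]
  rw [this, hSS, hAdef, sub_sub_cancel, smul_smul, mul_inv_cancel₀ hc0.ne', one_smul]

end SquareRoot

/-! ### Covariance operators and the Hilbert space `H₀ = B^{1/2} H` -/

/-- A strictly positive bounded operator `B > 0`. (That `B` is nuclear need not be recorded: it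
is automatic as soon as `B` is the covariance operator of a Gaussian measure.) -/
structure PosOperator (H : Type*) [NormedAddCommGroup H] [InnerProductSpace ℝ H] where
  toCLM : H →L[ℝ] H
  isPositive : toCLM.IsPositive
  inner_pos : ∀ x : H, x ≠ 0 → 0 < ⟪toCLM x, x⟫

section CameronMartin

variable {H : Type*} [NormedAddCommGroup H] [InnerProductSpace ℝ H] [CompleteSpace H]

/-- The positive square root `B^{1/2}`. -/
def PosOperator.sqrt (B : PosOperator H) : H →L[ℝ] H :=
  (exists_posSqrt B.isPositive).choose

lemma PosOperator.sqrt_isPositive (B : PosOperator H) : B.sqrt.IsPositive :=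
  (exists_posSqrt B.isPositive).choose_spec.1

lemma PosOperator.sqrt_sqrt (B : PosOperator H) (x : H) : B.sqrt (B.sqrt x) = B.toCLM x :=
  DFunLike.congr_fun (exists_posSqrt B.isPositive).choose_spec.2 x

lemma PosOperator.sqrt_injective (B : PosOperator H) :
    Function.Injective (B.sqrt : H →ₗ[ℝ] H) := by
  rw [injective_iff_map_eq_zero]
  intro x hx
  by_contra hne
  have h := B.inner_pos x hne
  rw [← B.sqrt_sqrt, show B.sqrt x = 0 from hx] at h
  simp at h

/-- The space `H₀ = B^{1/2} H`. It is a type of its own, so that it carries the inner product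
`⟪x, y⟫₀ = ⟪B^{-1/2} x, B^{-1/2} y⟫` rather than the one of `H`. -/
def CameronMartin (B : PosOperator H) : Type _ := LinearMap.range (B.sqrt : H →ₗ[ℝ] H)

namespace CameronMartin

variable (B : PosOperator H)

instance : AddCommGroup (CameronMartin B) :=
  inferInstanceAs (AddCommGroup (LinearMap.range (B.sqrt : H →ₗ[ℝ] H)))

instance : Module ℝ (CameronMartin B) :=
  inferInstanceAs (Module ℝ (LinearMap.range (B.sqrt : H →ₗ[ℝ] H)))

/-- The inclusion `H₀ ⊆ H`. -/
def toH : CameronMartin B →ₗ[ℝ] H :=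
  (LinearMap.range (B.sqrt : H →ₗ[ℝ] H)).subtype

/-- The bijection `B^{1/2} : H → H₀`. -/
def sqrtEquiv : H ≃ₗ[ℝ] CameronMartin B :=
  LinearEquiv.ofInjective (B.sqrt : H →ₗ[ℝ] H) B.sqrt_injective

instance : NormedAddCommGroup (CameronMartin B) :=
  NormedAddCommGroup.induced (CameronMartin B) H (sqrtEquiv B).symm (sqrtEquiv B).symm.injective

/-- `⟪x, y⟫₀ = ⟪B^{-1/2} x, B^{-1/2} y⟫`. -/
instance : InnerProductSpace ℝ (CameronMartin B) where
  norm_smul_le c x := by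
    change ‖(sqrtEquiv B).symm (c • x)‖ ≤ ‖c‖ * ‖(sqrtEquiv B).symm x‖
    rw [map_smul, norm_smul]
  inner x y := ⟪(sqrtEquiv B).symm x, (sqrtEquiv B).symm y⟫
  norm_sq_eq_re_inner x := norm_sq_eq_re_inner (𝕜 := ℝ) ((sqrtEquiv B).symm x)
  conj_inner_symm x y := inner_conj_symm (𝕜 := ℝ) ((sqrtEquiv B).symm x) ((sqrtEquiv B).symm y)
  add_left x y z := by simp [inner_add_left]
  smul_left x y r := by simp [real_inner_smul_left]

/-- The map `u ↦ B u`, from `H` onto the dense subspace `B H` of `H₀`. -/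
def applyB : H →ₗ[ℝ] CameronMartin B :=
  (sqrtEquiv B).toLinearMap ∘ₗ (B.sqrt : H →ₗ[ℝ] H)

lemma toH_applyB (u : H) : toH B (applyB B u) = B.toCLM u := B.sqrt_sqrt u

end CameronMartin

end CameronMartin

/-! ### Gaussian measures, measurable linear functionals, exponential functions -/

section Gaussian

variable {H : Type*} [NormedAddCommGroup H] [InnerProductSpace ℝ H] [CompleteSpace H]
  [MeasurableSpace H] [BorelSpace H]

/-- `μ` is the centred Gaussian measure `μ_B` with covariance operator `B`: its characteristic
functional is `y ↦ exp (-⟪B y, y⟫ / 2)`. -/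
def IsGaussianMeasure (B : PosOperator H) (μ : Measure H) : Prop :=
  ∀ y : H, charFun μ y = Complex.exp (-(⟪B.toCLM y, y⟫ / 2 : ℝ))

/-- `u ↦ ⟪u, ·⟫`, as an element of `L²(H, μ)`. -/
def innerLp (μ : Measure H) : H →ₗ[ℝ] Lp ℝ 2 μ where
  toFun u := StrongDual.toLp μ 2 (innerSL ℝ u)
  map_add' u v := by rw [map_add, map_add]
  map_smul' c u := by simp only [map_smulₛₗ, conj_trivial, RingHom.id_apply]

/-- The isometric embedding `l : H₀ → L²(H, μ_B)`, `y ↦ l_y = ⟪B⁻¹ y, ·⟫`: the extension by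
continuity of the map which sends `B u` to `⟪u, ·⟫`, for `u` in `H`. -/
def linearFunctional (B : PosOperator H) (μ : Measure H) : CameronMartin B →L[ℝ] Lp ℝ 2 μ :=
  (innerLp μ).extendOfNorm (CameronMartin.applyB B)

/-- The function `exp_h (x) = exp (⟪B⁻¹ h, x⟫ - ‖h‖₀² / 2)`. -/
def expFun {B : PosOperator H} (μ : Measure H) (h : CameronMartin B) (x : H) : ℝ :=
  Real.exp (linearFunctional B μ h x - ‖h‖ ^ 2 / 2)

end Gaussian

/-! ### Affine operators -/

/-- The element `A = (f, V)` of `Aff(K) = K ⋊ O(K)`; it acts on `K` by `A h = f + V h`. -/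
@[ext]
structure Aff (K : Type*) [NormedAddCommGroup K] [InnerProductSpace ℝ K] where
  f : K
  V : K ≃ₗᵢ[ℝ] K

namespace Aff

variable {K : Type*} [NormedAddCommGroup K] [InnerProductSpace ℝ K]

instance : Mul (Aff K) := ⟨fun A A' => ⟨A.f + A.V A'.f, A.V * A'.V⟩⟩
instance : One (Aff K) := ⟨⟨0, 1⟩⟩
instance : Inv (Aff K) := ⟨fun A => ⟨-(A.V⁻¹ A.f), A.V⁻¹⟩⟩

lemma mul_def (A A' : Aff K) : A * A' = ⟨A.f + A.V A'.f, A.V * A'.V⟩ := rfl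
lemma one_def : (1 : Aff K) = ⟨0, 1⟩ := rfl
lemma inv_def (A : Aff K) : A⁻¹ = ⟨-(A.V⁻¹ A.f), A.V⁻¹⟩ := rfl

instance : Group (Aff K) :=
  Group.ofLeftAxioms
    (fun A A' A'' => by ext1 <;> simp [mul_def, add_assoc, mul_assoc])
    (fun A => by ext1 <;> simp [mul_def, one_def])
    (fun A => by ext1 <;> simp [mul_def, one_def, inv_def])

/-- `α_t (f, V) = (t f, V)`. -/
def scale (t : ℝ) (A : Aff K) : Aff K := ⟨t • A.f, A.V⟩

/-- The vector `f^{(n)}` in `(f, V)^n = (f^{(n)}, V^n)`. -/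
def iter (A : Aff K) (n : ℕ) : K := (A ^ n).f

/-- The Poincaré exponent
`δ_A = inf {α > 0 | ∑_{n ≥ 1} exp (-α ‖f^{(n)}‖²) < ∞}`, an element of `[0, ∞]`. -/
def poincareExponent (A : Aff K) : ℝ≥0∞ :=
  sInf (ENNReal.ofReal ''
    {α : ℝ | 0 < α ∧ Summable fun n : ℕ => Real.exp (-α * ‖A.iter (n + 1)‖ ^ 2)})

end Aff

/-! ### Nonsingular transformations -/

section Nonsingular

variable {X : Type*} [MeasurableSpace X]

/-- `T` is a nonsingular transformation of `(X, μ)`: it is invertible and `μ ∘ T⁻¹ ∼ μ`. -/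
def IsNonsingular (μ : Measure X) (T : X ≃ᵐ X) : Prop :=
  μ.map T ≪ μ ∧ μ ≪ μ.map T

/-- The Koopman operator `U_T g = g ∘ T⁻¹ · √(d(μ ∘ T⁻¹)/dμ)`. -/
def koopman (μ : Measure X) (T : X ≃ᵐ X) (g : X → ℝ) (x : X) : ℝ :=
  g (T.symm x) * √((μ.map T).rnDeriv μ x).toReal

/-- `T` is totally dissipative: up to a null set, `X` is the disjoint union of the sets
`T^n W`, `n ∈ ℤ`, for some wandering set `W`. -/
def TotallyDissipative (μ : Measure X) (T : X ≃ᵐ X) : Prop :=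
  ∃ W : Set X, MeasurableSet W ∧
    Pairwise (Function.onFun Disjoint fun n : ℤ => ((T.toEquiv : Equiv.Perm X) ^ n) '' W) ∧
    ∀ᵐ x ∂μ, x ∈ ⋃ n : ℤ, ((T.toEquiv : Equiv.Perm X) ^ n) '' W

end Nonsingular

/-! ### Nonsingular Gaussian transformations -/

section Transformation

variable {H : Type*} [NormedAddCommGroup H] [InnerProductSpace ℝ H] [CompleteSpace H]
  [MeasurableSpace H] [BorelSpace H] {B : PosOperator H}

/-- The image `W_A exp_h = exp (-⟪f, V h⟫₀ - ‖f‖₀² / 2) exp_{f + V h}` of `exp_h` under the Weyl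
operator `W_A`, `A = (f, V)`. As the functions `exp_h` are total in `L²(H, μ_B)`, these values
determine the unitary operator `W_A`. -/
def weylExp (μ : Measure H) (A : Aff (CameronMartin B)) (h : CameronMartin B) (x : H) : ℝ :=
  Real.exp (-⟪A.f, A.V h⟫ - ‖A.f‖ ^ 2 / 2) * expFun μ (A.f + A.V h) x

/-- `T` is (a representative, modulo null sets, of) the nonsingular Gaussian transformation
generated by `A`, i.e. it is nonsingular and its Koopman operator `U_T` is the Weyl operator
`W_{α_{1/2}(A)}`. -/
def IsGaussianTransformation (μ : Measure H) (A : Aff (CameronMartin B)) (T : H ≃ᵐ H) : Prop :=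
  IsNonsingular μ T ∧
    ∀ h : CameronMartin B, koopman μ T (expFun μ h) =ᵐ[μ] weylExp μ (A.scale (1 / 2)) h

/-- The nonsingular Gaussian transformation `T_A` generated by `A`, i.e. the transformation with
`U_{T_A} = W_{α_{1/2}(A)}`; it is unique up to null sets, and a representative is chosen. -/
def gaussianTransformation (μ : Measure H) (A : Aff (CameronMartin B)) : H ≃ᵐ H :=
  Classical.epsilon (IsGaussianTransformation μ A)

/-- `τ ∈ [0, ∞]` is the dissipativity threshold `t_diss(A)`: the transformation `T_{α_t(A)}` is
conservative for `0 < t < τ` and totally dissipative for `t > τ`. -/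
def IsDissipativityThreshold (μ : Measure H) (A : Aff (CameronMartin B)) (τ : ℝ≥0∞) : Prop :=
  ∀ t : ℝ, 0 < t →
    (ENNReal.ofReal t < τ → Conservative (gaussianTransformation μ (A.scale t)) μ) ∧
    (τ < ENNReal.ofReal t → TotallyDissipative μ (gaussianTransformation μ (A.scale t)))

end Transformation

end NonsingularGaussian

end

open NonsingularGaussian

noncomputable section

namespace NonsingularGaussian

open ProbabilityTheory

set_option linter.unusedSectionVars false

/-! Formally `T_A` is `x ↦ f + V x`. By Cameron–Martin its density `d(μ ∘ T_A⁻¹)/dμ` is `exp_f`, and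
that of `T_A^n` is `exp_{f^(n)}`. Everything is read off from the sum `S_A` of these densities over
`n ∈ ℤ` (`densitySum`). If `S_A` is infinite almost everywhere, no set of positive measure is
wandering (`Implements.conservative`). If it is finite, almost every orbit has a last point of
maximal density, and these points form a wandering set whose translates fill the space
(`Implements.totallyDissipative`).

One of the two cases always occurs (`densitySum_zero_one`): translation by `g - V⁻¹ g` changes every
`l_{f^(n)}` by at most `2‖f‖‖g‖`, so it preserves finiteness of `S_A`. These vectors are dense
because `V` has no fixed vector, and a set invariant under a dense family of Cameron–Martin
translations is null or conull. Finiteness persists when the scale grows (`densitySum_scale_mono`):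
for `u² = t² + s²`, rotation invariance of `μ × μ` factors `exp_{u h}` as `exp_{t h}(x) exp_{s
h}(y)`, and `exp_{s h}` has integral one. Hence the threshold exists.

For the bounds, `∫ √exp_h dμ = e^{-‖h‖²/8}`, so convergence of the Poincaré series at `t²/8` makes
the sum for `α_t(A)` finite. Conversely `exp_h ≥ e^{-‖h‖²/2}` on a half-space of measure at least
`1/2`, so finiteness forces convergence at `t²/2`.

The transformation itself is built as a translation composed with a Borel automorphism inducing `V`
(`exists_implements`). -/

/-! ### Realizing mod-null isomorphisms by Borel automorphisms -/

section StandardBorel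

variable {X : Type*} [MeasurableSpace X] [StandardBorelSpace X] {μ : Measure X}

/-- An uncountable Borel set contains an uncountable null Borel subset. -/
lemma exists_not_countable_null_subset [SFinite μ] {s : Set X} (hs : MeasurableSet s)
    (hsc : ¬ s.Countable) :
    ∃ N ⊆ s, MeasurableSet N ∧ ¬ N.Countable ∧ μ N = 0 := by
  have : StandardBorelSpace s := hs.standardBorel
  have hℝ : ¬ Countable (ℝ × ℝ) := fun h =>
    not_countable (α := ℝ) ((Prod.mk_right_injective (0 : ℝ)).countable)
  -- In the plane there are uncountably many disjoint uncountable fibres, and only countably many of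
  -- them can have positive measure.
  let e : (ℝ × ℝ) ≃ᵐ s :=
    PolishSpace.measurableEquivOfNotCountable hℝ (by rwa [Set.countable_coe_iff])
  have hemb : MeasurableEmbedding (fun p : ℝ × ℝ => (e p : X)) :=
    (MeasurableEmbedding.subtype_coe hs).comp e.measurableEmbedding
  let F : ℝ → Set X := fun a => (fun p : ℝ × ℝ => (e p : X)) '' (Prod.fst ⁻¹' {a})
  have hFm : ∀ a, MeasurableSet (F a) := fun a =>
    hemb.measurableSet_image.2 (measurable_fst (measurableSet_singleton a))
  have hFd : Pairwise (Function.onFun Disjoint F) := fun a b hab => by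
    refine (Set.disjoint_image_iff hemb.injective).2 (Set.disjoint_left.2 fun p hp hq => hab ?_)
    rw [← (show p.1 = a from hp), ← (show p.1 = b from hq)]
  have hcount := Measure.countable_meas_pos_of_disjoint_iUnion (μ := μ) hFm hFd
  obtain ⟨a, ha⟩ : ∃ a, a ∉ {a | 0 < μ (F a)} := by
    by_contra! h
    exact Set.not_countable_univ (α := ℝ) (hcount.mono fun a _ => h a)
  refine ⟨F a, ?_, hFm a, fun hc => ?_, by simpa using ha⟩
  · rintro _ ⟨p, -, rfl⟩
    exact (e p).2
  · have h1 := (Set.countable_of_injective_of_countable_image hemb.injective.injOn hc)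
    have h2 : (Prod.mk a) ⁻¹' (Prod.fst ⁻¹' {a}) = (Set.univ : Set ℝ) := by ext; simp
    exact Set.not_countable_univ (h2 ▸ h1.preimage (Prod.mk_right_injective a))

/-- A measurable map with an almost everywhere left inverse agrees almost everywhere with a Borel
automorphism. -/
lemma exists_measurableEquiv_ae_eq [IsProbabilityMeasure μ] [NullSingletonClass μ] {S S' : X → X}
    (hS : Measurable S) (hS' : Measurable S') (h : ∀ᵐ x ∂μ, S' (S x) = x) :
    ∃ E : X ≃ᵐ X, ∀ᵐ x ∂μ, E x = S x := by
  classical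
  let := upgradeStandardBorel X
  set X₀ : Set X := {x | S' (S x) = x} with hX₀
  have hX₀m : MeasurableSet X₀ := measurableSet_eq_fun (hS'.comp hS) measurable_id
  have hX₀c : ¬ X₀.Countable := fun hc => by
    have h1 : μ X₀ᶜ = 0 := h
    have h2 := hc.measure_zero μ
    have := measure_add_measure_compl (μ := μ) hX₀m
    simp [h1, h2] at this
  -- `S` is already a Borel bijection of `X₀` onto its image, but the two complements might have
  -- different cardinalities. Removing an uncountable null set `N` makes both complements
  -- uncountable, hence Borel isomorphic.
  obtain ⟨N, hNX, hNm, hNc, hN0⟩ := exists_not_countable_null_subset (μ := μ) hX₀m hX₀c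
  set X₁ : Set X := X₀ \ N with hX₁
  have hX₁m : MeasurableSet X₁ := hX₀m.diff hNm
  set Y₁ : Set X := {y | S (S' y) = y ∧ S' y ∉ N} with hY₁
  have hY₁m : MeasurableSet Y₁ :=
    (measurableSet_eq_fun (hS.comp hS') measurable_id).inter (hS' hNm.compl)
  have hS₁ : ∀ x ∈ X₁, S x ∈ Y₁ := fun x hx => by
    have h1 : S' (S x) = x := hx.1
    exact ⟨by rw [h1], by rw [h1]; exact hx.2⟩
  have hS₂ : ∀ y ∈ Y₁, S' y ∈ X₁ := fun y hy =>
    ⟨by change S' (S (S' y)) = S' y; rw [hy.1], hy.2⟩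
  let e₁ : X₁ ≃ᵐ Y₁ :=
    { toFun := fun x => ⟨S x, hS₁ x x.2⟩
      invFun := fun y => ⟨S' y, hS₂ y y.2⟩
      left_inv := fun x => Subtype.ext x.2.1
      right_inv := fun y => Subtype.ext y.2.1
      measurable_toFun := (hS.comp measurable_subtype_coe).subtype_mk (h := fun x => hS₁ x x.2)
      measurable_invFun := (hS'.comp measurable_subtype_coe).subtype_mk (h := fun y => hS₂ y y.2) }
  have : StandardBorelSpace (X₁ᶜ : Set X) := hX₁m.compl.standardBorel
  have : StandardBorelSpace (Y₁ᶜ : Set X) := hY₁m.compl.standardBorel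
  have hXc : ¬ Countable (X₁ᶜ : Set X) := by
    rw [Set.countable_coe_iff]
    intro hc
    have hsub : N ⊆ X₁ᶜ := fun x hx hx1 => hx1.2 hx
    exact hNc (hc.mono hsub)
  have hYc : ¬ Countable (Y₁ᶜ : Set X) := by
    rw [Set.countable_coe_iff]
    intro hc
    refine hNc (Set.countable_of_injective_of_countable_image (f := S) ?_ (hc.mono ?_))
    · intro x hx y hy hxy
      rw [← (show S' (S x) = x from hNX hx), ← (show S' (S y) = y from hNX hy), hxy]
    · rintro _ ⟨x, hx, rfl⟩ hy
      exact hy.2 (by rw [show S' (S x) = x from hNX hx]; exact hx)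
  let e₂ : (X₁ᶜ : Set X) ≃ᵐ (Y₁ᶜ : Set X) := PolishSpace.measurableEquivOfNotCountable hXc hYc
  refine ⟨(MeasurableEquiv.sumCompl hX₁m).symm.trans
    ((MeasurableEquiv.sumCongr e₁ e₂).trans (MeasurableEquiv.sumCompl hY₁m)), ?_⟩
  have hX₁ae : ∀ᵐ x ∂μ, x ∈ X₁ := by
    filter_upwards [h, measure_eq_zero_iff_ae_notMem.1 hN0] with x h1 h2 using ⟨h1, h2⟩
  filter_upwards [hX₁ae] with x hx
  have : (MeasurableEquiv.sumCompl hX₁m).symm x = Sum.inl ⟨x, hx⟩ := by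
    rw [MeasurableEquiv.symm_apply_eq]; rfl
  simp only [MeasurableEquiv.trans_apply, this]
  rfl

end StandardBorel

/-! ### The Cameron–Martin space and its embedding into `L²` -/

section CameronMartin

variable {H : Type*} [NormedAddCommGroup H] [InnerProductSpace ℝ H] [CompleteSpace H]
  (B : PosOperator H)

namespace CameronMartin

lemma norm_eq_norm_symm (h : CameronMartin B) : ‖h‖ = ‖(sqrtEquiv B).symm h‖ := rfl

lemma inner_eq_inner_symm (h k : CameronMartin B) :
    ⟪h, k⟫ = ⟪(sqrtEquiv B).symm h, (sqrtEquiv B).symm k⟫ := rfl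

/-- `B^{1/2}`, as an isometry of `H` onto `H₀`. -/
def sqrtIsometry : H ≃ₗᵢ[ℝ] CameronMartin B where
  toLinearEquiv := sqrtEquiv B
  norm_map' x := by
    rw [norm_eq_norm_symm, LinearEquiv.symm_apply_apply]

instance : CompleteSpace (CameronMartin B) :=
  (sqrtIsometry B).toIsometryEquiv.completeSpace_iff.1 inferInstance

lemma toH_eq (h : CameronMartin B) : toH B h = B.sqrt ((sqrtEquiv B).symm h) := by
  obtain ⟨x, rfl⟩ := (sqrtEquiv B).surjective h
  rw [LinearEquiv.symm_apply_apply]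
  rfl

lemma inner_applyB (u : H) (h : CameronMartin B) : ⟪applyB B u, h⟫ = ⟪u, toH B h⟫ := by
  rw [inner_eq_inner_symm, toH_eq]
  simp only [applyB, LinearMap.comp_apply, LinearEquiv.coe_coe, LinearEquiv.symm_apply_apply]
  exact B.sqrt_isPositive.isSymmetric u _

lemma norm_applyB_sq (u : H) : ‖applyB B u‖ ^ 2 = ⟪B.toCLM u, u⟫ := by
  rw [← real_inner_self_eq_norm_sq, inner_applyB, toH_applyB, real_inner_comm]

/-- By `inner_applyB`, a vector of `H₀` orthogonal to `B H` in `H₀` is orthogonal to all of `H` in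
`H`. -/
lemma denseRange_applyB : DenseRange (applyB B) := by
  have h : (LinearMap.range (applyB B)).topologicalClosure = ⊤ := by
    rw [Submodule.topologicalClosure_eq_top_iff, Submodule.eq_bot_iff]
    intro h hh
    have h1 : ∀ u, ⟪u, toH B h⟫ = 0 := fun u => by
      rw [← inner_applyB]
      exact (Submodule.mem_orthogonal _ _).1 hh _ ⟨u, rfl⟩
    have h2 : toH B h = 0 := by simpa using h1 (toH B h)
    exact Subtype.ext h2
  exact Submodule.dense_iff_topologicalClosure_eq_top.2 h

end CameronMartin

end CameronMartin

/-! ### Gaussian laws of the functionals `l_k`. -/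

section Gaussian

open CameronMartin

variable {H : Type*} [NormedAddCommGroup H] [InnerProductSpace ℝ H] [CompleteSpace H]
  [SecondCountableTopology H] [MeasurableSpace H] [BorelSpace H] {B : PosOperator H}
  {μ : Measure H} [IsProbabilityMeasure μ]

lemma IsGaussianMeasure.map_inner (hμ : IsGaussianMeasure B μ) (u : H) :
    μ.map (fun x => ⟪u, x⟫) = gaussianReal 0 (‖applyB B u‖₊ ^ 2) := by
  have hm : Measurable fun x : H => ⟪u, x⟫ := by fun_prop
  have : IsProbabilityMeasure (μ.map fun x : H => ⟪u, x⟫) :=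
    Measure.isProbabilityMeasure_map hm.aemeasurable
  refine Measure.ext_of_charFun (funext fun t => ?_)
  have h1 := hμ (t • u)
  rw [charFun_apply] at h1
  rw [charFun_gaussianReal, charFun_apply_real, integral_map hm.aemeasurable (by fun_prop)]
  have h2 : ∀ x : H, Complex.exp ((t : ℂ) * ((⟪u, x⟫ : ℝ) : ℂ) * Complex.I) =
      Complex.exp (((⟪x, t • u⟫ : ℝ) : ℂ) * Complex.I) := fun x => by
    rw [real_inner_smul_right, real_inner_comm]
    push_cast
    rfl
  simp_rw [h2]
  rw [h1, map_smul, inner_smul_left, inner_smul_right, ← norm_applyB_sq]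
  congr 1
  simp
  ring

lemma IsGaussianMeasure.isGaussian (hμ : IsGaussianMeasure B μ) : IsGaussian μ := by
  constructor
  intro L
  obtain ⟨u, rfl⟩ := (InnerProductSpace.toDual ℝ H).surjective L
  have h := hμ.map_inner u
  have hm : Measurable fun x : H => ⟪u, x⟫ := by fun_prop
  have e1 : ∫ x, ⟪u, x⟫ ∂μ = 0 := by
    have := integral_map (μ := μ) hm.aemeasurable (f := fun y : ℝ => y) (by fun_prop)
    rw [← this, h, integral_id_gaussianReal]
  have e2 : Var[fun x => ⟪u, x⟫; μ] = ‖applyB B u‖ ^ 2 := by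
    have := variance_map (μ := μ) (X := fun y : ℝ => y) (by fun_prop) hm.aemeasurable
    rw [h, variance_fun_id_gaussianReal] at this
    simpa [Function.comp_def] using this.symm
  have e3 : (‖applyB B u‖ ^ 2).toNNReal = ‖applyB B u‖₊ ^ 2 := by
    ext
    simp [Real.coe_toNNReal _ (sq_nonneg ‖applyB B u‖)]
  change μ.map (fun x => ⟪u, x⟫) =
    gaussianReal (∫ x, ⟪u, x⟫ ∂μ) (Var[fun x => ⟪u, x⟫; μ]).toNNReal
  rw [e1, e2, h, e3]

/-- A Gaussian measure with an atom is a Dirac mass; here `⟪u, ·⟫` has variance `⟪B u, u⟫ > 0` for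
`u ≠ 0`. -/
lemma IsGaussianMeasure.nullSingletonClass (hμ : IsGaussianMeasure B μ) [Nontrivial H] :
    NullSingletonClass μ := by
  have := hμ.isGaussian
  refine IsGaussian.nullSingletonClass fun x hx => ?_
  obtain ⟨u, hu⟩ := exists_ne (0 : H)
  have h1 := hμ.map_inner u
  have hm : Measurable fun x : H => ⟪u, x⟫ := by fun_prop
  rw [hx, Measure.map_dirac' hm, ← gaussianReal_zero_var, gaussianReal_ext_iff] at h1
  have h2 := B.inner_pos u hu
  rw [← norm_applyB_sq] at h2
  have h3 : ‖applyB B u‖₊ = 0 := by simpa using h1.2.symm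
  rw [← coe_nnnorm, h3] at h2
  simp at h2

/-- The finite second moment of a Gaussian measure makes `StrongDual.toLp` represent the actual
functional. -/
lemma IsGaussianMeasure.innerLp_coe (hμ : IsGaussianMeasure B μ) (u : H) :
    innerLp μ u =ᵐ[μ] fun x => ⟪u, x⟫ := by
  have := hμ.isGaussian
  have h : innerLp μ u = MemLp.toLp (innerSL ℝ u : H → ℝ)
      (ContinuousLinearMap.comp_memLp' (innerSL ℝ u) (IsGaussian.memLp_two_id (μ := μ))) :=
    StrongDual.toLp_apply IsGaussian.memLp_two_id (innerSL ℝ u)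
  rw [h]
  exact MemLp.coeFn_toLp _

lemma IsGaussianMeasure.norm_innerLp (hμ : IsGaussianMeasure B μ) (u : H) :
    ‖innerLp μ u‖ = ‖applyB B u‖ := by
  have h := hμ.map_inner u
  have hm : Measurable fun x : H => ⟪u, x⟫ := by fun_prop
  rw [← sq_eq_sq₀ (norm_nonneg _) (norm_nonneg _), ← real_inner_self_eq_norm_sq, L2.inner_def]
  have e1 : ∫ x, ⟪innerLp μ u x, innerLp μ u x⟫ ∂μ = ∫ x, ⟪u, x⟫ ^ 2 ∂μ := by
    refine integral_congr_ae ?_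
    filter_upwards [hμ.innerLp_coe u] with x hx
    rw [hx]
    simp [pow_two]
  have e2 : ∫ x, ⟪u, x⟫ ^ 2 ∂μ = ∫ y, y ^ 2 ∂(gaussianReal 0 (‖applyB B u‖₊ ^ 2)) := by
    rw [← h, integral_map hm.aemeasurable (by fun_prop)]
  rw [e1, e2, ← variance_of_integral_eq_zero (X := fun y : ℝ => y) (by fun_prop)
    integral_id_gaussianReal, variance_fun_id_gaussianReal]
  simp

/-- Density of `B H` and the isometry `norm_innerLp` are the two conditions under which
`extendOfNorm` is a genuine extension. -/
lemma linearFunctional_applyB (hμ : IsGaussianMeasure B μ) (u : H) :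
    linearFunctional B μ (applyB B u) = innerLp μ u :=
  LinearMap.extendOfNorm_eq (denseRange_applyB B)
    ⟨1, fun x => by rw [one_mul, hμ.norm_innerLp]⟩ u

lemma linearFunctional_applyB_coe (hμ : IsGaussianMeasure B μ) (u : H) :
    linearFunctional B μ (applyB B u) =ᵐ[μ] fun x => ⟪u, x⟫ := by
  rw [linearFunctional_applyB hμ]
  exact hμ.innerLp_coe u

lemma measurable_linearFunctional (h : CameronMartin B) : Measurable (linearFunctional B μ h) :=
  (Lp.stronglyMeasurable _).measurable

lemma linearFunctional_add (h k : CameronMartin B) :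
    linearFunctional B μ (h + k) =ᵐ[μ] fun x => linearFunctional B μ h x + linearFunctional B μ k x := by
  rw [map_add]
  exact Lp.coeFn_add _ _

lemma linearFunctional_smul (c : ℝ) (h : CameronMartin B) :
    linearFunctional B μ (c • h) =ᵐ[μ] fun x => c * linearFunctional B μ h x := by
  rw [map_smul]
  exact Lp.coeFn_smul _ _

/-- A sequence converging in `L²` converges almost everywhere along a subsequence. -/
lemma exists_subseq_tendsto_ae {Y : Type*} [MeasurableSpace Y] {ν : Measure Y} {g : ℕ → Lp ℝ 2 ν}
    {g₀ : Lp ℝ 2 ν} (h : Tendsto g atTop (𝓝 g₀)) :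
    ∃ ns : ℕ → ℕ, StrictMono ns ∧ ∀ᵐ y ∂ν, Tendsto (fun j => g (ns j) y) atTop (𝓝 (g₀ y)) :=
  (tendstoInMeasure_of_tendsto_Lp h).exists_seq_tendsto_ae

/-- Every `l_k` is almost everywhere a limit of functions `⟪u_j, ·⟫`. -/
lemma exists_seq_inner_tendsto (hμ : IsGaussianMeasure B μ) (k : CameronMartin B) :
    ∃ u : ℕ → H, Tendsto (fun j => applyB B (u j)) atTop (𝓝 k) ∧
      ∀ᵐ x ∂μ, Tendsto (fun j => ⟪u j, x⟫) atTop (𝓝 (linearFunctional B μ k x)) := by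
  obtain ⟨v, hv, hvk⟩ := mem_closure_iff_seq_limit.1 ((denseRange_applyB B) k)
  choose u hu using hv
  obtain ⟨ns, hns, hae⟩ := exists_subseq_tendsto_ae
    (((linearFunctional B μ).continuous.tendsto k).comp hvk)
  refine ⟨fun j => u (ns j), ?_, ?_⟩
  · simp_rw [hu]
    exact hvk.comp hns.tendsto_atTop
  · filter_upwards [hae, ae_all_iff.2 fun j => linearFunctional_applyB_coe hμ (u (ns j))]
      with x hx hx'
    simp_rw [← hx', hu]
    exact hx

/-- Pulling back the functionals `l_k` along a nonsingular map is determined by the pullbacks of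
the functionals `⟪u, ·⟫`. -/
lemma linearFunctional_comp_ae (hμ : IsGaussianMeasure B μ) {Y : Type*} [MeasurableSpace Y]
    {ν : Measure Y} {Φ : Y → H} (hΦ : Measure.QuasiMeasurePreserving Φ ν μ)
    {M : CameronMartin B → Lp ℝ 2 ν} (hM : Continuous M)
    (h : ∀ u, ∀ᵐ y ∂ν, M (applyB B u) y = ⟪u, Φ y⟫) (k : CameronMartin B) :
    ∀ᵐ y ∂ν, linearFunctional B μ k (Φ y) = M k y := by
  obtain ⟨u, huk, hae⟩ := exists_seq_inner_tendsto hμ k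
  obtain ⟨ns, hns, hae'⟩ := exists_subseq_tendsto_ae ((hM.tendsto k).comp huk)
  filter_upwards [hΦ.ae hae, hae', ae_all_iff.2 fun j => h (u (ns j))] with y h1 h2 h3
  refine tendsto_nhds_unique (h1.comp hns.tendsto_atTop) ?_
  simpa only [Function.comp_def, h3] using h2

/-- The characteristic functions of `⟪u_j, ·⟫` converge by dominated convergence, while the
variances `‖B u_j‖₀²` tend to `‖k‖₀²`. -/
lemma map_linearFunctional (hμ : IsGaussianMeasure B μ) (k : CameronMartin B) :
    μ.map (linearFunctional B μ k) = gaussianReal 0 (‖k‖₊ ^ 2) := by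
  have hm := measurable_linearFunctional (μ := μ) k
  have : IsProbabilityMeasure (μ.map (linearFunctional B μ k)) :=
    Measure.isProbabilityMeasure_map hm.aemeasurable
  refine Measure.ext_of_charFun (funext fun t => ?_)
  obtain ⟨u, huk, hae⟩ := exists_seq_inner_tendsto hμ k
  rw [charFun_gaussianReal, charFun_apply_real, integral_map hm.aemeasurable (by fun_prop)]
  have h1 : Tendsto (fun j => ∫ x, Complex.exp ((t : ℂ) * ((⟪u j, x⟫ : ℝ) : ℂ) * Complex.I) ∂μ)
      atTop (𝓝 (∫ x, Complex.exp ((t : ℂ) * (linearFunctional B μ k x : ℂ) * Complex.I) ∂μ)) := by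
    refine tendsto_integral_of_dominated_convergence (fun _ => 1) (fun j => by fun_prop)
      (integrable_const _) (fun j => ae_of_all _ fun x => ?_) ?_
    · rw [← Complex.ofReal_mul, Complex.norm_exp_ofReal_mul_I]
    · filter_upwards [hae] with x hx
      have hc : Continuous fun y : ℝ => Complex.exp ((t : ℂ) * (y : ℂ) * Complex.I) := by fun_prop
      exact (hc.tendsto _).comp hx
  have h2 : ∀ j, ∫ x, Complex.exp ((t : ℂ) * ((⟪u j, x⟫ : ℝ) : ℂ) * Complex.I) ∂μ =
      Complex.exp (t * (0 : ℝ) * Complex.I - (‖applyB B (u j)‖ ^ 2 : ℝ) * t ^ 2 / 2) := fun j => by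
    have h3 : Measurable fun x : H => ⟪u j, x⟫ := by fun_prop
    have h4 := charFun_gaussianReal (μ := 0) (v := ‖applyB B (u j)‖₊ ^ 2) t
    rw [← hμ.map_inner, charFun_apply_real, integral_map h3.aemeasurable (by fun_prop)] at h4
    rw [h4]
    simp
  refine tendsto_nhds_unique h1 ?_
  simp_rw [h2]
  have hc : Continuous fun y : CameronMartin B =>
      Complex.exp (t * (0 : ℝ) * Complex.I - (‖y‖ ^ 2 : ℝ) * t ^ 2 / 2) := by fun_prop
  have h5 := (hc.tendsto k).comp huk
  simpa [Function.comp_def] using h5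

lemma integrable_exp_linearFunctional (hμ : IsGaussianMeasure B μ) (k : CameronMartin B) (c : ℝ) :
    Integrable (fun x => Real.exp (c * linearFunctional B μ k x)) μ := by
  have h := integrable_exp_mul_gaussianReal (μ := 0) (v := ‖k‖₊ ^ 2) c
  rw [← map_linearFunctional hμ] at h
  exact (integrable_map_measure (by fun_prop)
    (measurable_linearFunctional (μ := μ) k).aemeasurable).1 h

lemma integral_exp_linearFunctional (hμ : IsGaussianMeasure B μ) (k : CameronMartin B) (c : ℝ) :
    ∫ x, Real.exp (c * linearFunctional B μ k x) ∂μ = Real.exp (c ^ 2 * ‖k‖ ^ 2 / 2) := by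
  have h := mgf_gaussianReal (map_linearFunctional hμ k) c
  rw [mgf] at h
  rw [h]
  congr 1
  simp
  ring

lemma integral_exp_inner (hμ : IsGaussianMeasure B μ) (u : H) :
    Integrable (fun x => Real.exp ⟪u, x⟫) μ ∧
    ∫ x, Real.exp ⟪u, x⟫ ∂μ = Real.exp (‖applyB B u‖ ^ 2 / 2) := by
  have h : (fun x => Real.exp (1 * linearFunctional B μ (applyB B u) x)) =ᵐ[μ]
      fun x => Real.exp ⟪u, x⟫ := by
    filter_upwards [linearFunctional_applyB_coe hμ u] with x hx
    rw [one_mul, hx]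
  refine ⟨(integrable_exp_linearFunctional hμ _ 1).congr h, ?_⟩
  rw [← integral_congr_ae h, integral_exp_linearFunctional hμ, one_pow, one_mul]

/-! ### Laplace transforms and the Cameron–Martin formula -/

/-- Finite measures with the same finite Laplace transform are equal. -/
lemma ext_of_integral_exp_inner {ν₁ ν₂ : Measure H} [IsFiniteMeasure ν₁] [IsFiniteMeasure ν₂]
    (h₁ : ∀ u : H, Integrable (fun x => Real.exp ⟪u, x⟫) ν₁)
    (h : ∀ u : H, ∫ x, Real.exp ⟪u, x⟫ ∂ν₁ = ∫ x, Real.exp ⟪u, x⟫ ∂ν₂) : ν₁ = ν₂ := by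
  have hmass : ν₁.real Set.univ = ν₂.real Set.univ := by simpa using h 0
  have hzero : ν₁ = 0 ↔ ν₂ = 0 := by
    rw [← Measure.measure_univ_eq_zero, ← Measure.measure_univ_eq_zero (μ := ν₂),
      ← measureReal_eq_zero_iff, hmass, measureReal_eq_zero_iff]
  refine Measure.ext_of_charFun (funext fun u => ?_)
  have hmgf : mgf (fun x : H => ⟪u, x⟫) ν₁ = mgf (fun x : H => ⟪u, x⟫) ν₂ := by
    funext s
    simpa only [mgf, real_inner_smul_left] using h (s • u)
  have hset : integrableExpSet (fun x : H => ⟪u, x⟫) ν₁ = Set.univ := by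
    refine Set.eq_univ_of_forall fun s => ?_
    simpa only [real_inner_smul_left] using! h₁ (s • u)
  -- Both complex moment generating functions are analytic on the whole plane and agree on the real
  -- axis; their value at `i` is the characteristic function at `u`.
  have := eqOn_complexMGF_of_mgf' hmgf hzero (show Complex.I ∈ _ by simp [hset])
  simpa only [charFun_apply, complexMGF, mul_comm, real_inner_comm] using this

lemma measurable_expFun (h : CameronMartin B) : Measurable (expFun μ h) := by
  have := measurable_linearFunctional (μ := μ) h
  unfold expFun
  fun_prop

/-- The measure with density `exp_h` with respect to `μ`. -/
def expMeasure (μ : Measure H) (h : CameronMartin B) : Measure H :=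
  μ.withDensity fun x => ENNReal.ofReal (expFun μ h x)

lemma integrable_expFun (hμ : IsGaussianMeasure B μ) (h : CameronMartin B) :
    Integrable (expFun μ h) μ := by
  have := (integrable_exp_linearFunctional hμ h 1).mul_const (Real.exp (-(‖h‖ ^ 2 / 2)))
  simpa only [← Real.exp_add, one_mul, ← sub_eq_add_neg] using! this

lemma isFiniteMeasure_expMeasure (hμ : IsGaussianMeasure B μ) (h : CameronMartin B) :
    IsFiniteMeasure (expMeasure μ h) :=
  isFiniteMeasure_withDensity_ofReal (integrable_expFun hμ h).2

lemma exp_inner_mul_expFun (hμ : IsGaussianMeasure B μ) (h : CameronMartin B) (u : H) :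
    (fun x => expFun μ h x * Real.exp ⟪u, x⟫) =ᵐ[μ]
      fun x => Real.exp (-(‖h‖ ^ 2 / 2)) *
        Real.exp (1 * linearFunctional B μ (h + applyB B u) x) := by
  filter_upwards [linearFunctional_add h (applyB B u), linearFunctional_applyB_coe hμ u]
    with x h1 h2
  rw [h1, h2, expFun, ← Real.exp_add, ← Real.exp_add]
  ring_nf

lemma integral_expFun_mul_exp_inner (hμ : IsGaussianMeasure B μ) (h : CameronMartin B) (u : H) :
    Integrable (fun x => expFun μ h x * Real.exp ⟪u, x⟫) μ ∧
    ∫ x, expFun μ h x * Real.exp ⟪u, x⟫ ∂μ =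
      Real.exp (⟪u, toH B h⟫ + ‖applyB B u‖ ^ 2 / 2) := by
  have h1 := exp_inner_mul_expFun hμ h u
  refine ⟨((integrable_exp_linearFunctional hμ _ 1).const_mul _).congr h1.symm, ?_⟩
  rw [integral_congr_ae h1, integral_const_mul, integral_exp_linearFunctional hμ, ← Real.exp_add,
    norm_add_sq_real, real_inner_comm, inner_applyB]
  ring_nf

/-- **Cameron–Martin formula**. -/
lemma map_add_toH (hμ : IsGaussianMeasure B μ) (h : CameronMartin B) :
    μ.map (fun x => x + toH B h) = expMeasure μ h := by
  have hm : Measurable fun x : H => x + toH B h := by fun_prop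
  have := isFiniteMeasure_expMeasure hμ h
  -- The two measures are compared through their Laplace transforms, computed by absorbing `e^{⟪u,
  -- ·⟫}` into `exp_h` as `l_{h + B u}`.
  have hint : ∀ u : H, (∫ x, Real.exp ⟪u, x⟫ ∂(expMeasure μ h)) =
      Real.exp (⟪u, toH B h⟫ + ‖applyB B u‖ ^ 2 / 2) := fun u => by
    rw [expMeasure, integral_withDensity_eq_integral_toReal_smul
      (measurable_expFun h).ennreal_ofReal (by simp)]
    rw [← (integral_expFun_mul_exp_inner hμ h u).2]
    refine integral_congr_ae (ae_of_all _ fun x => ?_)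
    simp [ENNReal.toReal_ofReal, expFun, Real.exp_nonneg]
  refine ext_of_integral_exp_inner (fun u => ?_) fun u => ?_
  · rw [integrable_map_measure (by fun_prop) hm.aemeasurable]
    simpa only [Function.comp_def, inner_add_right, Real.exp_add] using
      (integral_exp_inner hμ u).1.mul_const (Real.exp ⟪u, toH B h⟫)
  · rw [hint, integral_map hm.aemeasurable (by fun_prop)]
    simp only [inner_add_right, Real.exp_add]
    rw [integral_mul_const, (integral_exp_inner hμ u).2, mul_comm]

end Gaussian

section Gaussian

open CameronMartin

variable {H : Type*} [NormedAddCommGroup H] [InnerProductSpace ℝ H] [CompleteSpace H]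
  [SecondCountableTopology H] [MeasurableSpace H] [BorelSpace H] {B : PosOperator H}
  {μ : Measure H} [IsProbabilityMeasure μ]

/-! ### Translations and rotations -/

lemma expMeasure_absolutelyContinuous (h : CameronMartin B) : expMeasure μ h ≪ μ :=
  withDensity_absolutelyContinuous _ _

lemma quasiMeasurePreserving_add_toH (hμ : IsGaussianMeasure B μ) (h : CameronMartin B) :
    Measure.QuasiMeasurePreserving (fun x => x + toH B h) μ μ :=
  ⟨by fun_prop, by rw [map_add_toH hμ]; exact expMeasure_absolutelyContinuous h⟩

/-- For `k = B u` the shift is `⟪u, h⟫ = ⟪B u, h⟫₀`; the general case is a limit, legitimate because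
translation by `h` preserves null sets. -/
lemma linearFunctional_add_toH (hμ : IsGaussianMeasure B μ) (k h : CameronMartin B) :
    ∀ᵐ x ∂μ, linearFunctional B μ k (x + toH B h) = linearFunctional B μ k x + ⟪k, h⟫ := by
  let M : CameronMartin B → Lp ℝ 2 μ := fun k =>
    linearFunctional B μ k + Lp.constL 2 μ ℝ (⟪k, h⟫ : ℝ)
  have hM : Continuous M := by fun_prop
  have hMc : ∀ k, ∀ᵐ x ∂μ, M k x = linearFunctional B μ k x + ⟪k, h⟫ := fun k => by
    filter_upwards [Lp.coeFn_add (linearFunctional B μ k) (Lp.constL 2 μ ℝ (⟪k, h⟫ : ℝ)),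
      Lp.coeFn_const (p := 2) (μ := μ) (⟪k, h⟫ : ℝ)] with x h1 h2
    rw [h1, Pi.add_apply]
    exact congrArg _ h2
  filter_upwards [linearFunctional_comp_ae hμ (quasiMeasurePreserving_add_toH hμ h) hM
    (fun u => by
      filter_upwards [hMc (applyB B u), linearFunctional_applyB_coe hμ u] with x h1 h2
      rw [h1, h2, inner_add_right, inner_applyB]) k, hMc k] with x h1 h2
  rw [h1, h2]

/-- The sum of independent Gaussians with covariances `c² B` and `s² B` has covariance `B`. -/
lemma map_rotation (hμ : IsGaussianMeasure B μ) {c s : ℝ} (hcs : c ^ 2 + s ^ 2 = 1) :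
    MeasurePreserving (fun p : H × H => c • p.1 + s • p.2) (μ.prod μ) μ := by
  have hm : Measurable fun p : H × H => c • p.1 + s • p.2 := by fun_prop
  have hsplit : ∀ u : H, (fun p : H × H => Real.exp ⟪u, c • p.1 + s • p.2⟫) =
      fun p : H × H => Real.exp ⟪c • u, p.1⟫ * Real.exp ⟪s • u, p.2⟫ := fun u => by
    funext p
    rw [← Real.exp_add, inner_add_right]
    simp only [real_inner_smul_left, real_inner_smul_right]
  have : IsProbabilityMeasure ((μ.prod μ).map fun p : H × H => c • p.1 + s • p.2) :=
    Measure.isProbabilityMeasure_map hm.aemeasurable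
  refine ⟨hm, ext_of_integral_exp_inner (fun u => ?_) fun u => ?_⟩
  · rw [integrable_map_measure (by fun_prop) hm.aemeasurable, Function.comp_def, hsplit]
    exact (integral_exp_inner hμ _).1.mul_prod (integral_exp_inner hμ _).1
  · rw [integral_map hm.aemeasurable (by fun_prop), hsplit,
      integral_prod_mul (fun x => Real.exp ⟪c • u, x⟫) (fun x => Real.exp ⟪s • u, x⟫),
      (integral_exp_inner hμ _).2, (integral_exp_inner hμ _).2, (integral_exp_inner hμ _).2,
      ← Real.exp_add]
    congr 1
    simp only [map_smul, norm_smul, Real.norm_eq_abs, mul_pow, sq_abs]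
    linear_combination (‖applyB B u‖ ^ 2 / 2) * hcs

lemma linearFunctional_rotation (hμ : IsGaussianMeasure B μ) {c s : ℝ} (hcs : c ^ 2 + s ^ 2 = 1)
    (k : CameronMartin B) :
    ∀ᵐ p ∂(μ.prod μ), linearFunctional B μ k (c • p.1 + s • p.2) =
      c * linearFunctional B μ k p.1 + s * linearFunctional B μ k p.2 := by
  have hfst : MeasurePreserving (Prod.fst : H × H → H) (μ.prod μ) μ := measurePreserving_fst
  have hsnd : MeasurePreserving (Prod.snd : H × H → H) (μ.prod μ) μ := measurePreserving_snd
  let M : CameronMartin B → Lp ℝ 2 (μ.prod μ) := fun k =>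
    c • Lp.compMeasurePreservingₗᵢ ℝ Prod.fst hfst (linearFunctional B μ k) +
      s • Lp.compMeasurePreservingₗᵢ ℝ Prod.snd hsnd (linearFunctional B μ k)
  have hM : Continuous M := by fun_prop
  have hMc : ∀ k, ∀ᵐ p ∂(μ.prod μ), M k p =
      c * linearFunctional B μ k p.1 + s * linearFunctional B μ k p.2 := fun k => by
    filter_upwards [Lp.coeFn_add
        (c • Lp.compMeasurePreservingₗᵢ ℝ Prod.fst hfst (linearFunctional B μ k))
        (s • Lp.compMeasurePreservingₗᵢ ℝ Prod.snd hsnd (linearFunctional B μ k)),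
      Lp.coeFn_smul c (Lp.compMeasurePreservingₗᵢ ℝ Prod.fst hfst (linearFunctional B μ k)),
      Lp.coeFn_smul s (Lp.compMeasurePreservingₗᵢ ℝ Prod.snd hsnd (linearFunctional B μ k)),
      Lp.coeFn_compMeasurePreserving (linearFunctional B μ k) hfst,
      Lp.coeFn_compMeasurePreserving (linearFunctional B μ k) hsnd] with p h1 h2 h3 h4 h5
    rw [h1, Pi.add_apply, h2, h3, Pi.smul_apply, Pi.smul_apply, smul_eq_mul, smul_eq_mul]
    exact congrArg₂ _ (congrArg _ h4) (congrArg _ h5)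
  filter_upwards [linearFunctional_comp_ae hμ (map_rotation hμ hcs).quasiMeasurePreserving hM
    (fun u => by
      filter_upwards [hMc (applyB B u),
        hfst.quasiMeasurePreserving.ae (linearFunctional_applyB_coe hμ u),
        hsnd.quasiMeasurePreserving.ae (linearFunctional_applyB_coe hμ u)] with p h1 h2 h3
      rw [h1, h2, h3, inner_add_right, real_inner_smul_right, real_inner_smul_right]) k, hMc k]
    with p h1 h2
  rw [h1, h2]

/-! ### The zero-one law -/

lemma expMeasure_univ (hμ : IsGaussianMeasure B μ) (h : CameronMartin B) :
    expMeasure μ h Set.univ = 1 := by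
  rw [← map_add_toH hμ, Measure.map_apply (by fun_prop) MeasurableSet.univ]
  simp

/-- For `h ∈ D` equality holds by Cameron–Martin. Fatou's lemma, along `h → k`, keeps one
inequality; the other comes later from the complement of `E`. -/
lemma expMeasure_le_of_dense_invariant (hμ : IsGaussianMeasure B μ) {D : Set (CameronMartin B)}
    (hD : Dense D) {E : Set H} (hE : MeasurableSet E)
    (hinv : ∀ h ∈ D, ∀ᵐ x ∂μ, x + toH B h ∈ E ↔ x ∈ E) (k : CameronMartin B) :
    expMeasure μ k E ≤ μ E := by
  have hDE : ∀ h ∈ D, expMeasure μ h E = μ E := fun h hh => by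
    rw [← map_add_toH hμ, Measure.map_apply (by fun_prop) hE]
    exact measure_congr ((hinv h hh).mono fun x hx => propext hx)
  obtain ⟨v, hv, hvk⟩ := mem_closure_iff_seq_limit.1 (hD k)
  obtain ⟨ns, hns, hae⟩ := exists_subseq_tendsto_ae
    (((linearFunctional B μ).continuous.tendsto k).comp hvk)
  have hexp : ∀ᵐ x ∂μ, Tendsto (fun j => ENNReal.ofReal (expFun μ (v (ns j)) x)) atTop
      (𝓝 (ENNReal.ofReal (expFun μ k x))) := by
    filter_upwards [hae] with x hx
    refine ENNReal.tendsto_ofReal ((Real.continuous_exp.tendsto _).comp (hx.sub ?_))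
    have hc : Continuous fun y : CameronMartin B => ‖y‖ ^ 2 / 2 := by fun_prop
    exact (hc.tendsto k).comp (hvk.comp hns.tendsto_atTop)
  calc expMeasure μ k E = ∫⁻ x in E, ENNReal.ofReal (expFun μ k x) ∂μ :=
        withDensity_apply _ hE
    _ = ∫⁻ x in E, liminf (fun j => ENNReal.ofReal (expFun μ (v (ns j)) x)) atTop ∂μ :=
        lintegral_congr_ae (ae_restrict_of_ae (hexp.mono fun x hx => hx.liminf_eq.symm))
    _ ≤ liminf (fun j => ∫⁻ x in E, ENNReal.ofReal (expFun μ (v (ns j)) x) ∂μ) atTop :=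
        lintegral_liminf_le fun j => (measurable_expFun _).ennreal_ofReal
    _ = μ E := by
        have : ∀ j, ∫⁻ x in E, ENNReal.ofReal (expFun μ (v (ns j)) x) ∂μ = μ E := fun j => by
          rw [← hDE _ (hv (ns j)), expMeasure, withDensity_apply _ hE]
        simp [this]

/-- A set which is invariant under a dense set of Cameron–Martin translations is trivial. -/
lemma measure_eq_zero_or_compl_of_dense_invariant (hμ : IsGaussianMeasure B μ)
    {D : Set (CameronMartin B)} (hD : Dense D) {E : Set H} (hE : MeasurableSet E)
    (hinv : ∀ h ∈ D, ∀ᵐ x ∂μ, x + toH B h ∈ E ↔ x ∈ E) : μ E = 0 ∨ μ Eᶜ = 0 := by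
  have hEk : ∀ k, expMeasure μ k E = μ E := fun k => by
    refine le_antisymm (expMeasure_le_of_dense_invariant hμ hD hE hinv k) ?_
    have h1 := expMeasure_le_of_dense_invariant hμ hD hE.compl
      (fun h hh => (hinv h hh).mono fun x hx => not_congr hx) k
    have h2 : expMeasure μ k E + expMeasure μ k Eᶜ = μ E + μ Eᶜ := by
      rw [measure_add_measure_compl hE, measure_add_measure_compl hE, expMeasure_univ hμ,
        measure_univ]
    by_contra! hlt
    have := ENNReal.add_lt_add_of_lt_of_le (measure_ne_top μ _ |>.lt_top.trans_le' h1).ne hlt h1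
    exact this.ne h2
  have hval : ∀ u : H, ∫ x in E, Real.exp ⟪u, x⟫ ∂μ =
      μ.real E * Real.exp (‖applyB B u‖ ^ 2 / 2) := fun u => by
    have h1 : ∫ x in E, expFun μ (applyB B u) x ∂μ = μ.real E := by
      rw [integral_eq_lintegral_of_nonneg_ae (f := expFun μ (applyB B u)) (ae_of_all _ fun x => (Real.exp_pos _).le)
        (measurable_expFun _).aestronglyMeasurable, ← withDensity_apply _ hE]
      exact congrArg ENNReal.toReal (hEk (applyB B u))
    rw [← h1, ← integral_mul_const]
    refine integral_congr_ae (ae_restrict_of_ae ?_)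
    filter_upwards [linearFunctional_applyB_coe hμ u] with x hx
    rw [expFun, hx, ← Real.exp_add, sub_add_cancel]
  -- Invariance of the mass of `E` under every `exp_{B u}` says that both measures have the same
  -- Laplace transform. Evaluating at `Eᶜ` gives `μ(E) μ(Eᶜ) = 0`.
  have heq : μ.restrict E = (μ E) • μ := by
    have : IsFiniteMeasure ((μ E) • μ) := μ.smul_finite (measure_ne_top μ E)
    refine ext_of_integral_exp_inner (fun u => (integral_exp_inner hμ u).1.integrableOn)
      fun u => ?_
    rw [hval, integral_smul_measure, (integral_exp_inner hμ u).2, smul_eq_mul]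
    rfl
  have h0 := congrArg (fun ν => ν Eᶜ) heq
  simp only [Measure.restrict_apply hE.compl, Set.compl_inter_self, measure_empty,
    Measure.smul_apply, smul_eq_mul] at h0
  exact mul_eq_zero.1 h0.symm

end Gaussian

section Gaussian

open CameronMartin

variable {H : Type*} [NormedAddCommGroup H] [InnerProductSpace ℝ H] [CompleteSpace H]
  [SecondCountableTopology H] [MeasurableSpace H] [BorelSpace H] {B : PosOperator H}
  {μ : Measure H} [IsProbabilityMeasure μ]

/-! ### Second quantization of orthogonal operators as measure preserving maps -/

lemma countable_of_hilbertBasis {ι E : Type*} [NormedAddCommGroup E] [InnerProductSpace ℝ E]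
    [SecondCountableTopology E] (b : HilbertBasis ι ℝ E) : Countable ι := by
  have hdist : ∀ i j, i ≠ j → 1 ≤ dist (b i) (b j) := fun i j hij => by
    have h1 : ‖b i - b j‖ ^ 2 = 2 := by
      rw [norm_sub_sq_real, b.orthonormal.1, b.orthonormal.1, b.orthonormal.2 hij]
      norm_num
    rw [dist_eq_norm]
    nlinarith [norm_nonneg (b i - b j)]
  have hd : Set.PairwiseDisjoint (Set.univ : Set ι) fun i => Metric.ball (b i) (1 / 2) :=
    fun i _ j _ hij => Metric.ball_disjoint_ball (by linarith [hdist i j hij])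
  exact Set.countable_univ_iff.1 (hd.countable_of_isOpen (fun i _ => Metric.isOpen_ball)
    fun i _ => ⟨b i, Metric.mem_ball_self (by norm_num)⟩)

lemma continuous_applyB : Continuous (applyB B) :=
  (sqrtIsometry B).continuous.comp B.sqrt.continuous

lemma lintegral_linearFunctional_sq (hμ : IsGaussianMeasure B μ) (k : CameronMartin B) :
    ∫⁻ x, ENNReal.ofReal (linearFunctional B μ k x ^ 2) ∂μ = ENNReal.ofReal (‖k‖ ^ 2) := by
  have hm := measurable_linearFunctional (μ := μ) k
  have hint : Integrable (fun y : ℝ => y ^ 2) (gaussianReal 0 (‖k‖₊ ^ 2)) :=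
    (memLp_id_gaussianReal 2).integrable_sq
  have h1 : ∫ y, y ^ 2 ∂(gaussianReal 0 (‖k‖₊ ^ 2)) = ‖k‖ ^ 2 := by
    rw [← variance_of_integral_eq_zero (X := fun y : ℝ => y) (by fun_prop)
      integral_id_gaussianReal, variance_fun_id_gaussianReal]
    simp
  rw [← h1, ofReal_integral_eq_lintegral_ofReal hint (ae_of_all _ fun y => sq_nonneg y),
    ← map_linearFunctional hμ, lintegral_map (by fun_prop) hm]

/-- `l_{V B u}`, for `u` in `H`, is represented as `⟪u, S ·⟫` for a measurable map `S`. -/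
lemma exists_measurable_inner_eq (hμ : IsGaussianMeasure B μ)
    (V : CameronMartin B ≃ₗᵢ[ℝ] CameronMartin B) :
    ∃ S : H → H, Measurable S ∧
      ∀ u, ∀ᵐ x ∂μ, linearFunctional B μ (V (applyB B u)) x = ⟪u, S x⟫ := by
  classical
  have := hμ.isGaussian
  obtain ⟨w, b, -⟩ := exists_hilbertBasis ℝ H
  have := countable_of_hilbertBasis b
  let L : w → H → ℝ := fun i => linearFunctional B μ (V (applyB B (b i)))
  have hLm : ∀ i, Measurable (L i) := fun i => measurable_linearFunctional _
  let G : Set H := {x | ∑' i, ENNReal.ofReal (L i x ^ 2) ≠ ∞}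
  have hGm : MeasurableSet G :=
    (Measurable.tsum fun i => ((hLm i).pow_const 2).ennreal_ofReal)
      (measurableSet_singleton ∞).compl
  have hG : ∀ᵐ x ∂μ, x ∈ G := by
    -- Since `V` is isometric, `L i` has the same second moment as `⟪b i, ·⟫`, so the integral
    -- equals `∫ ‖x‖² dμ`. Thus `∑ L i x • b i` converges for almost every `x`, and defines `S`.
    have hfin : ∫⁻ x, ∑' i, ENNReal.ofReal (L i x ^ 2) ∂μ ≠ ∞ := by
      have h1 : ∀ i, ∫⁻ x, ENNReal.ofReal (L i x ^ 2) ∂μ = ∫⁻ x, ENNReal.ofReal (⟪b i, x⟫ ^ 2) ∂μ :=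
        fun i => by
          rw [lintegral_linearFunctional_sq hμ, V.norm_map, ← lintegral_linearFunctional_sq hμ]
          refine lintegral_congr_ae ?_
          filter_upwards [linearFunctional_applyB_coe hμ (b i)] with x hx
          rw [hx]
      have h2 : ∀ x : H, ∑' i, ENNReal.ofReal (⟪b i, x⟫ ^ 2) = ENNReal.ofReal (‖x‖ ^ 2) := fun x => by
        have h3 := b.hasSum_inner_mul_inner x x
        have h4 : ∀ i, ⟪x, b i⟫ * ⟪b i, x⟫ = ⟪b i, x⟫ ^ 2 := fun i => by
          rw [real_inner_comm, pow_two]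
        simp_rw [h4, real_inner_self_eq_norm_sq] at h3
        rw [← h3.tsum_eq, ENNReal.ofReal_tsum_of_nonneg (fun i => sq_nonneg _) h3.summable]
      rw [lintegral_tsum fun i => ((hLm i).pow_const 2).ennreal_ofReal.aemeasurable]
      simp_rw [h1]
      rw [← lintegral_tsum fun i => by fun_prop]
      simp_rw [h2]
      have h5 : Integrable (fun x : H => ‖x‖ ^ 2) μ :=
        (IsGaussian.memLp_two_id (μ := μ)).norm.integrable_sq
      rw [← ofReal_integral_eq_lintegral_ofReal h5 (ae_of_all _ fun x => by positivity)]
      exact ENNReal.ofReal_ne_top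
    filter_upwards [ae_lt_top (Measurable.tsum fun i =>
      ((hLm i).pow_const 2).ennreal_ofReal) hfin] with x hx using hx.ne
  have hmem : ∀ x ∈ G, Memℓp (fun i => L i x) 2 := fun x hx => by
    refine memℓp_gen ?_
    have h1 : Summable fun i => (ENNReal.ofReal (L i x ^ 2)).toReal := ENNReal.summable_toReal hx
    simpa [ENNReal.toReal_ofReal, sq_nonneg] using h1
  let S : H → H := fun x => if hx : x ∈ G then b.repr.symm ⟨_, hmem x hx⟩ else 0
  have hSb : ∀ x ∈ G, ∀ i, ⟪b i, S x⟫ = L i x := fun x hx i => by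
    rw [← b.repr_apply_apply]
    simp only [S, dif_pos hx, LinearIsometryEquiv.apply_symm_apply]
  have hS : Measurable S := by
    refine measurable_of_tendsto_metrizable' (atTop : Filter (Finset w))
      (f := fun s => G.indicator fun x => ∑ i ∈ s, L i x • b i) (fun s => ?_) ?_
    · exact (Finset.measurable_fun_sum s fun i _ => (hLm i).smul_const _).indicator hGm
    · rw [tendsto_pi_nhds]
      intro x
      by_cases hx : x ∈ G
      · simp only [Set.indicator_of_mem hx, S, dif_pos hx]
        exact b.hasSum_repr_symm ⟨_, hmem x hx⟩
      · simp only [Set.indicator_of_notMem hx, S, dif_neg hx]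
        exact tendsto_const_nhds
  refine ⟨S, hS, ?_⟩
  -- The vectors `u` satisfying the identity form a closed subspace, and the basis vectors belong to
  -- it.
  let p : Submodule ℝ H :=
    { carrier := {u | ∀ᵐ x ∂μ, linearFunctional B μ (V (applyB B u)) x = ⟪u, S x⟫}
      zero_mem' := by
        simp only [Set.mem_ofPred_eq, map_zero, inner_zero_left]
        exact Lp.coeFn_zero _ _ _
      add_mem' := fun {u v} hu hv => by
        simp only [Set.mem_ofPred_eq, map_add V, map_add (applyB B)] at hu hv ⊢
        filter_upwards [hu, hv, linearFunctional_add (μ := μ) (V (applyB B u)) (V (applyB B v))]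
          with x h1 h2 h3
        rw [h3, h1, h2, inner_add_left]
      smul_mem' := fun c u hu => by
        simp only [Set.mem_ofPred_eq, map_smul V, map_smul (applyB B)] at hu ⊢
        filter_upwards [hu, linearFunctional_smul (μ := μ) c (V (applyB B u))] with x h1 h3
        rw [h3, h1, real_inner_smul_left] }
  have hp : IsClosed (p : Set H) := by
    refine IsSeqClosed.isClosed fun v u hv hvu => ?_
    obtain ⟨ns, hns, hae⟩ := exists_subseq_tendsto_ae
      ((((linearFunctional B μ).continuous.comp (V.continuous.comp continuous_applyB)).tendsto
        u).comp hvu)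
    change ∀ᵐ x ∂μ, linearFunctional B μ (V (applyB B u)) x = ⟪u, S x⟫
    filter_upwards [hae, ae_all_iff.2 fun j => (hv (ns j) :
      ∀ᵐ x ∂μ, linearFunctional B μ (V (applyB B (v (ns j)))) x = ⟪v (ns j), S x⟫)] with x h1 h2
    refine tendsto_nhds_unique h1 ?_
    simp only [Function.comp_apply, h2]
    exact (hvu.comp hns.tendsto_atTop).inner tendsto_const_nhds
  have htop : p = ⊤ := by
    rw [eq_top_iff, ← b.dense_span]
    refine Submodule.topologicalClosure_minimal _ (Submodule.span_le.2 ?_) hp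
    rintro _ ⟨i, rfl⟩
    filter_upwards [hG] with x hx using (hSb x hx i).symm
  intro u
  exact (htop ▸ Submodule.mem_top : u ∈ p)

/-- Every orthogonal operator `V` of the Cameron–Martin space is induced by a measure preserving
map `S` of `H`. -/
lemma exists_measurePreserving_comp (hμ : IsGaussianMeasure B μ)
    (V : CameronMartin B ≃ₗᵢ[ℝ] CameronMartin B) :
    ∃ S : H → H, MeasurePreserving S μ μ ∧
      ∀ k, ∀ᵐ x ∂μ, linearFunctional B μ k (S x) = linearFunctional B μ (V k) x := by
  obtain ⟨S, hS, hSu⟩ := exists_measurable_inner_eq hμ V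
  have hexp : ∀ u : H, (fun x => Real.exp (1 * linearFunctional B μ (V (applyB B u)) x)) =ᵐ[μ]
      fun x => Real.exp ⟪u, S x⟫ := fun u => by
    filter_upwards [hSu u] with x hx
    rw [one_mul, hx]
  have : IsProbabilityMeasure (μ.map S) := Measure.isProbabilityMeasure_map hS.aemeasurable
  have hmp : MeasurePreserving S μ μ := by
    refine ⟨hS, ext_of_integral_exp_inner (fun u => ?_) fun u => ?_⟩
    · rw [integrable_map_measure (by fun_prop) hS.aemeasurable]
      exact (integrable_exp_linearFunctional hμ _ 1).congr (hexp u)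
    · rw [integral_map hS.aemeasurable (by fun_prop), ← integral_congr_ae (hexp u),
        integral_exp_linearFunctional hμ, (integral_exp_inner hμ u).2, V.norm_map, one_pow, one_mul]
  refine ⟨S, hmp, linearFunctional_comp_ae hμ hmp.quasiMeasurePreserving
    (M := fun k => linearFunctional B μ (V k)) ?_ hSu⟩
  exact (linearFunctional B μ).continuous.comp V.continuous

/-- Every orthogonal operator `V` of the Cameron–Martin space is induced by a measure preserving
Borel automorphism of `H`. -/
lemma exists_measurableEquiv_comp (hμ : IsGaussianMeasure B μ) [Nontrivial H]
    (V : CameronMartin B ≃ₗᵢ[ℝ] CameronMartin B) :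
    ∃ S : H ≃ᵐ H, MeasurePreserving S μ μ ∧
      ∀ k, ∀ᵐ x ∂μ, linearFunctional B μ k (S x) = linearFunctional B μ (V k) x := by
  obtain ⟨S, hS, hSk⟩ := exists_measurePreserving_comp hμ V
  obtain ⟨S', hS', hSk'⟩ := exists_measurePreserving_comp hμ V.symm
  -- The maps induced by `V` and `V⁻¹` cancel on each `⟪u, ·⟫`; a countable dense set of `u` gives
  -- one null set for all `u`.
  have hinv : ∀ᵐ x ∂μ, S' (S x) = x := by
    have h1 : ∀ u : H, ∀ᵐ x ∂μ, ⟪u, S' (S x)⟫ = ⟪u, x⟫ := fun u => by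
      filter_upwards [(hS'.comp hS).quasiMeasurePreserving.ae (linearFunctional_applyB_coe hμ u),
        hS.quasiMeasurePreserving.ae (hSk' (applyB B u)), hSk (V.symm (applyB B u)),
        linearFunctional_applyB_coe hμ u] with x h1 h2 h3 h4
      rw [Function.comp_apply] at h1
      rw [← h1, h2, h3, V.apply_symm_apply, h4]
    filter_upwards [ae_all_iff.2 fun n => h1 (TopologicalSpace.denseSeq H n)] with x hx
    refine ext_inner_left ℝ fun u => ?_
    refine congrFun ((TopologicalSpace.denseRange_denseSeq H).equalizer
      (g := fun u => ⟪u, S' (S x)⟫) (h := fun u => ⟪u, x⟫) (by fun_prop) (by fun_prop) ?_) u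
    funext n
    exact hx n
  have := hμ.nullSingletonClass
  obtain ⟨E, hE⟩ := exists_measurableEquiv_ae_eq hS.measurable hS'.measurable hinv
  refine ⟨E, ⟨E.measurable, ?_⟩, fun k => ?_⟩
  · rw [Measure.map_congr hE, hS.map_eq]
  · filter_upwards [hE, hSk k] with x h1 h2
    rw [h1, h2]

end Gaussian

/-! ### Affine operators and the transformations implementing them -/

section Gaussian

open CameronMartin

variable {H : Type*} [NormedAddCommGroup H] [InnerProductSpace ℝ H] [CompleteSpace H]
  [SecondCountableTopology H] [MeasurableSpace H] [BorelSpace H] {B : PosOperator H}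
  {μ : Measure H} [IsProbabilityMeasure μ]

/-- `T` acts on the measure `μ` and on the functionals `l_k` as `x ↦ f + V x` should. -/
structure Implements (μ : Measure H) (A : Aff (CameronMartin B)) (T : H ≃ᵐ H) : Prop where
  map_eq : μ.map T = expMeasure μ A.f
  comp_symm : ∀ k, ∀ᵐ x ∂μ,
    linearFunctional B μ k (T.symm x) = linearFunctional B μ (A.V k) x - ⟪A.f, A.V k⟫

lemma absolutelyContinuous_expMeasure (h : CameronMartin B) : μ ≪ expMeasure μ h :=
  withDensity_absolutelyContinuous' (measurable_expFun h).ennreal_ofReal.aemeasurable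
    (ae_of_all _ fun x => by simp [expFun, Real.exp_pos])

lemma quasiMeasurePreserving_symm {X : Type*} [MeasurableSpace X] {ν : Measure X} {T : X ≃ᵐ X}
    (h : ν ≪ ν.map T) : Measure.QuasiMeasurePreserving T.symm ν ν := by
  refine ⟨T.symm.measurable, ?_⟩
  have h1 := h.map T.symm.measurable
  rwa [T.map_symm_map] at h1

lemma linearFunctional_zero : ∀ᵐ x ∂μ, linearFunctional B μ 0 x = 0 := by
  rw [map_zero]
  exact Lp.coeFn_zero _ _ _

lemma linearFunctional_neg (h : CameronMartin B) :
    ∀ᵐ x ∂μ, linearFunctional B μ (-h) x = -linearFunctional B μ h x := by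
  rw [map_neg]
  exact Lp.coeFn_neg _

namespace Implements

variable {A A' : Aff (CameronMartin B)} {T T' : H ≃ᵐ H}

lemma quasiMeasurePreserving (h : Implements μ A T) : Measure.QuasiMeasurePreserving T μ μ :=
  ⟨T.measurable, by rw [h.map_eq]; exact expMeasure_absolutelyContinuous _⟩

lemma quasiMeasurePreserving_symm (h : Implements μ A T) :
    Measure.QuasiMeasurePreserving T.symm μ μ :=
  NonsingularGaussian.quasiMeasurePreserving_symm
    (by rw [h.map_eq]; exact absolutelyContinuous_expMeasure _)

/-- The term `-⟪f, V k⟫` in `comp_symm` is the cross term of `-‖f + V k‖²/2`. This is the cocycle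
identity behind products and powers. -/
lemma expFun_comp_symm (h : Implements μ A T) (k : CameronMartin B) :
    ∀ᵐ x ∂μ, expFun μ (A.f + A.V k) x = expFun μ A.f x * expFun μ k (T.symm x) := by
  filter_upwards [h.comp_symm k, linearFunctional_add (μ := μ) A.f (A.V k)] with x h1 h2
  rw [expFun, expFun, expFun, h1, h2, ← Real.exp_add, norm_add_sq_real, A.V.norm_map]
  ring_nf

lemma map_withDensity {X : Type*} [MeasurableSpace X] {ν : Measure X} (T : X ≃ᵐ X)
    {ρ : X → ℝ≥0∞} (hρ : Measurable ρ) :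
    (ν.withDensity ρ).map T = (ν.map T).withDensity fun x => ρ (T.symm x) := by
  ext s hs
  rw [T.map_apply, withDensity_apply _ (T.measurable hs), withDensity_apply _ hs,
    setLIntegral_map (f := fun y => ρ (T.symm y)) hs (hρ.comp T.symm.measurable) T.measurable]
  simp

lemma mul (h : Implements μ A T) (h' : Implements μ A' T') :
    Implements μ (A * A') (T'.trans T) where
  map_eq := by
    rw [show ⇑(T'.trans T) = T ∘ T' from rfl, ← Measure.map_map T.measurable T'.measurable,
      h'.map_eq, expMeasure, map_withDensity T (measurable_expFun _).ennreal_ofReal, h.map_eq,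
      expMeasure, expMeasure, ← withDensity_mul _ (measurable_expFun _).ennreal_ofReal
        (g := fun x => ENNReal.ofReal (expFun μ A'.f (T.symm x)))
        ((measurable_expFun _).ennreal_ofReal.comp T.symm.measurable)]
    refine withDensity_congr_ae ?_
    filter_upwards [h.expFun_comp_symm A'.f] with x hx
    simp only [Pi.mul_apply, Aff.mul_def]
    rw [hx, ENNReal.ofReal_mul (by exact (Real.exp_pos _).le)]
  comp_symm k := by
    filter_upwards [h.quasiMeasurePreserving_symm.ae (h'.comp_symm k), h.comp_symm (A'.V k)]
      with x h1 h2
    change linearFunctional B μ k (T'.symm (T.symm x)) = _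
    rw [h1, h2]
    simp only [Aff.mul_def]
    change _ = linearFunctional B μ (A.V (A'.V k)) x - ⟪A.f + A.V A'.f, A.V (A'.V k)⟫
    rw [inner_add_left, A.V.inner_map_map]
    ring

lemma inv (h : Implements μ A T) : Implements μ A⁻¹ T.symm := by
  have hV : ∀ k, A.V (A.V⁻¹ k) = k := fun k => A.V.apply_symm_apply k
  have hV' : ∀ k l, ⟪A.V⁻¹ k, A.V⁻¹ l⟫ = ⟪k, l⟫ := fun k l => A.V.symm.inner_map_map k l
  have hcomp : ∀ k, ∀ᵐ x ∂μ, linearFunctional B μ k (T x) =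
      linearFunctional B μ (A.V⁻¹ k) x + ⟪A.f, k⟫ := fun k => by
    filter_upwards [h.quasiMeasurePreserving.ae (h.comp_symm (A.V⁻¹ k))] with x hx
    rw [T.symm_apply_apply, hV] at hx
    rw [hx]
    ring
  have hinv : Measurable fun x => ENNReal.ofReal (expFun μ A.f x)⁻¹ :=
    (measurable_expFun _).inv.ennreal_ofReal
  refine ⟨?_, fun k => ?_⟩
  -- Inverting the density of `T` expresses `μ` through its image, and `T⁻¹` sends that image back
  -- to `μ`.
  · have h1 : μ = (μ.map T).withDensity fun x => ENNReal.ofReal (expFun μ A.f x)⁻¹ := by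
      rw [h.map_eq, expMeasure, ← withDensity_mul _ (measurable_expFun _).ennreal_ofReal hinv]
      conv_lhs => rw [← withDensity_one (μ := μ)]
      refine withDensity_congr_ae (ae_of_all _ fun x => ?_)
      have hpos : 0 < expFun μ A.f x := Real.exp_pos _
      simp only [Pi.mul_apply, Pi.one_apply]
      rw [← ENNReal.ofReal_mul hpos.le, mul_inv_cancel₀ hpos.ne', ENNReal.ofReal_one]
    have h2 : μ.map T.symm = μ.withDensity fun x => ENNReal.ofReal (expFun μ A.f (T x))⁻¹ := by
      conv_lhs => rw [h1]
      rw [map_withDensity T.symm hinv, T.map_symm_map]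
      rfl
    rw [h2, expMeasure]
    refine withDensity_congr_ae ?_
    filter_upwards [hcomp A.f, linearFunctional_neg (μ := μ) (A.V⁻¹ A.f)] with x h3 h4
    have h5 : ‖A.V⁻¹ A.f‖ = ‖A.f‖ := A.V.symm.norm_map _
    simp only [Aff.inv_def]
    rw [expFun, expFun, h3, h4, ← Real.exp_neg, norm_neg, h5, real_inner_self_eq_norm_sq]
    ring_nf
  · filter_upwards [hcomp k] with x hx
    change linearFunctional B μ k (T x) = _
    rw [hx]
    simp only [Aff.inv_def]
    rw [inner_neg_left, hV', sub_neg_eq_add]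

lemma one : Implements μ (1 : Aff (CameronMartin B)) (MeasurableEquiv.refl H) where
  map_eq := by
    change μ.map id = _
    rw [expMeasure, Measure.map_id]
    conv_lhs => rw [← withDensity_one (μ := μ)]
    exact withDensity_congr_ae (ae_of_all _ fun x => by simp [expFun, Aff.one_def])
  comp_symm k := ae_of_all _ fun x => by
    simp [Aff.one_def, LinearIsometryEquiv.one_def]

/-- Total dissipativity speaks of powers in `Equiv.Perm`; this supplies their measurability and
their densities `exp_{f^(n)}`. -/
lemma zpow (h : Implements μ A T) (n : ℤ) :
    ∃ M : H ≃ᵐ H, M.toEquiv = (T.toEquiv : Equiv.Perm H) ^ n ∧ Implements μ (A ^ n) M := by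
  induction n with
  | zero => exact ⟨MeasurableEquiv.refl H, rfl, by simpa using Implements.one⟩
  | succ n ih =>
    obtain ⟨M, hM, hMi⟩ := ih
    refine ⟨T.trans M, ?_, by rw [zpow_add_one]; exact hMi.mul h⟩
    rw [zpow_add_one, ← hM]
    rfl
  | pred n ih =>
    obtain ⟨M, hM, hMi⟩ := ih
    refine ⟨T.symm.trans M, ?_, by rw [zpow_sub_one]; exact hMi.mul h.inv⟩
    rw [zpow_sub_one, ← hM]
    rfl

end Implements

/-- Take `T x = S⁻¹ x + f` with `l_k ∘ S = l_{V k}`; the inverse `x ↦ S (x - f)` then pulls `l_k`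
back to `l_{V k} - ⟪f, V k⟫`. -/
lemma exists_implements (hμ : IsGaussianMeasure B μ) [Nontrivial H] (A : Aff (CameronMartin B)) :
    ∃ T : H ≃ᵐ H, Implements μ A T := by
  obtain ⟨S, hS, hSk⟩ := exists_measurableEquiv_comp hμ A.V
  have hsymm : ∀ x, (S.symm.trans (MeasurableEquiv.addRight (toH B A.f))).symm x =
      S (x + toH B (-A.f)) := fun x => by
    rw [MeasurableEquiv.symm_apply_eq]
    simp
  refine ⟨S.symm.trans (MeasurableEquiv.addRight (toH B A.f)), ?_, fun k => ?_⟩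
  · rw [← map_add_toH hμ, MeasurableEquiv.coe_trans,
      ← Measure.map_map (MeasurableEquiv.measurable _) S.symm.measurable, (hS.symm S).map_eq]
    rfl
  · filter_upwards [(quasiMeasurePreserving_add_toH hμ (-A.f)).ae (hSk k),
      linearFunctional_add_toH hμ (A.V k) (-A.f)] with x h1 h2
    rw [hsymm, h1, h2, inner_neg_right, real_inner_comm, sub_eq_add_neg]

/-- The Koopman operator of a transformation implementing `A` is the Weyl operator. -/
lemma Implements.isGaussianTransformation {A : Aff (CameronMartin B)} {T : H ≃ᵐ H}
    (h : Implements μ A T) : IsGaussianTransformation μ A T := by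
  refine ⟨⟨?_, ?_⟩, fun k => ?_⟩
  · rw [h.map_eq]; exact expMeasure_absolutelyContinuous _
  · rw [h.map_eq]; exact absolutelyContinuous_expMeasure _
  · have hrn := Measure.rnDeriv_withDensity μ (measurable_expFun (μ := μ) A.f).ennreal_ofReal
    filter_upwards [hrn, h.comp_symm k, linearFunctional_smul (μ := μ) (1 / 2 : ℝ) A.f,
      linearFunctional_add (μ := μ) ((1 / 2 : ℝ) • A.f) (A.V k)] with x h1 h2 h3 h4
    rw [koopman, h.map_eq, expMeasure, h1, ENNReal.toReal_ofReal (by exact (Real.exp_pos _).le),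
      weylExp]
    simp only [Aff.scale]
    rw [expFun, expFun, expFun, h2, h4, h3, ← Real.exp_half, ← Real.exp_add, ← Real.exp_add,
      norm_add_sq_real, norm_smul, A.V.norm_map, real_inner_smul_left]
    congr 1
    norm_num
    ring

/-- A nonsingular transformation whose Koopman operator is the Weyl operator of `α_{1/2}(A)`
implements `A`. -/
lemma IsGaussianTransformation.implements {A : Aff (CameronMartin B)} {T : H ≃ᵐ H}
    (h : IsGaussianTransformation μ A T) : Implements μ A T := by
  have hT := quasiMeasurePreserving_symm h.1.2
  have : IsProbabilityMeasure (μ.map T) := Measure.isProbabilityMeasure_map T.measurable.aemeasurable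
  -- As `exp_0 = 1`, the Koopman operator at `h = 0` yields the square root of the density itself.
  -- Dividing by it for general `h` recovers `l_h ∘ T⁻¹`.
  have hsqrt : ∀ᵐ x ∂μ, √((μ.map T).rnDeriv μ x).toReal =
      Real.exp (linearFunctional B μ A.f x / 2 - ‖A.f‖ ^ 2 / 4) := by
    filter_upwards [h.2 0, hT.ae (linearFunctional_zero (B := B) (μ := μ)),
      linearFunctional_smul (μ := μ) (1 / 2 : ℝ) A.f] with x h1 h2 h3
    rw [koopman, weylExp, expFun, h2] at h1
    simp only [Aff.scale, map_zero, add_zero, inner_zero_right, neg_zero, norm_zero] at h1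
    rw [expFun, h3, ← Real.exp_add, norm_smul] at h1
    norm_num at h1
    rw [h1]
    congr 1
    ring
  refine ⟨?_, fun k => ?_⟩
  · rw [← Measure.withDensity_rnDeriv_eq _ _ h.1.1, expMeasure]
    refine withDensity_congr_ae ?_
    filter_upwards [hsqrt, Measure.rnDeriv_lt_top (μ.map T) μ] with x h1 h2
    rw [← ENNReal.ofReal_toReal h2.ne, ← Real.sq_sqrt (ENNReal.toReal_nonneg), h1,
      ← Real.exp_nat_mul, expFun]
    push_cast
    ring_nf
  · filter_upwards [h.2 k, hsqrt, linearFunctional_smul (μ := μ) (1 / 2 : ℝ) A.f,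
      linearFunctional_add (μ := μ) ((1 / 2 : ℝ) • A.f) (A.V k)] with x h1 h2 h3 h4
    rw [koopman, weylExp, h2] at h1
    simp only [Aff.scale] at h1
    rw [expFun, expFun, h4, h3, ← Real.exp_add, ← Real.exp_add, norm_add_sq_real, norm_smul,
      A.V.norm_map, real_inner_smul_left] at h1
    have h5 := Real.exp_injective h1
    norm_num at h5
    linarith

/-- Existence makes the `Classical.epsilon` choice satisfy its predicate, and every such choice
implements `A`, so the representative is immaterial. -/
lemma implements_gaussianTransformation (hμ : IsGaussianMeasure B μ) [Nontrivial H]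
    (A : Aff (CameronMartin B)) : Implements μ A (gaussianTransformation μ A) := by
  obtain ⟨T, hT⟩ := exists_implements hμ A
  exact (Classical.epsilon_spec (p := IsGaussianTransformation μ A)
    ⟨T, hT.isGaussianTransformation⟩).implements

end Gaussian

/-! ### Conservativity and dissipativity in terms of the Radon–Nikodym cocycle -/

/-- A positive summable family on `ℤ` attains its maximum, and there is a last place where it
does so. -/
lemma exists_last_argmax {F : ℤ → ℝ} (hF : ∀ n, 0 < F n) (hs : Summable F) :
    ∃ j, ∀ n, (n < j → F n ≤ F j) ∧ (j < n → F n < F j) := by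
  have hfin : {n | F 0 ≤ F n}.Finite := by
    have h := hs.tendsto_cofinite_zero.eventually (gt_mem_nhds (hF 0))
    rw [eventually_cofinite] at h
    simpa only [not_lt] using h
  -- The lexicographic order breaks ties between maximizers in favour of the largest index.
  obtain ⟨j, hj, hmax⟩ := hfin.toFinset.exists_max_image (fun n => toLex (F n, n))
    ⟨0, by simp⟩
  rw [hfin.mem_toFinset] at hj
  have key : ∀ n, F n < F j ∨ F n = F j ∧ n ≤ j := fun n => by
    by_cases hn : F 0 ≤ F n
    · exact (Prod.Lex.le_iff).1 (hmax n (by simpa using hn))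
    · exact Or.inl ((not_le.1 hn).trans_le hj)
  refine ⟨j, fun n => ⟨fun _ => ?_, fun hn => ?_⟩⟩
  · rcases key n with h | h
    exacts [h.le, h.1.le]
  · rcases key n with h | h
    exacts [h, absurd h.2 (not_le.2 hn)]

section Gaussian

open CameronMartin

variable {H : Type*} [NormedAddCommGroup H] [InnerProductSpace ℝ H] [CompleteSpace H]
  [SecondCountableTopology H] [MeasurableSpace H] [BorelSpace H] {B : PosOperator H}
  {μ : Measure H} [IsProbabilityMeasure μ]

/-- The sum over `n ∈ ℤ` of the densities `d(μ ∘ T⁻ⁿ)/dμ`, for a transformation `T` that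
implements `A`. -/
def densitySum (μ : Measure H) (A : Aff (CameronMartin B)) (x : H) : ℝ≥0∞ :=
  ∑' n : ℤ, ENNReal.ofReal (expFun μ (A ^ n).f x)

lemma measurable_densitySum (A : Aff (CameronMartin B)) : Measurable (densitySum μ A) :=
  Measurable.tsum fun _ => (measurable_expFun _).ennreal_ofReal

lemma expFun_pos (h : CameronMartin B) (x : H) : 0 < expFun μ h x := Real.exp_pos _

variable {A : Aff (CameronMartin B)} {T : H ≃ᵐ H}

lemma Implements.ae_zpow (h : Implements μ A T) {p : H → Prop} (hp : ∀ᵐ x ∂μ, p x) (n : ℤ) :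
    ∀ᵐ x ∂μ, p (((T.toEquiv : Equiv.Perm H) ^ n) x) := by
  obtain ⟨M, hM, hMi⟩ := h.zpow n
  rw [← hM]
  exact hMi.quasiMeasurePreserving.ae hp

lemma Implements.measurable_zpow (h : Implements μ A T) (n : ℤ) :
    Measurable ((T.toEquiv : Equiv.Perm H) ^ n) := by
  obtain ⟨M, hM, -⟩ := h.zpow n
  rw [← hM]
  exact M.measurable

lemma Implements.ae_cocycle (h : Implements μ A T) (n m : ℤ) :
    ∀ᵐ x ∂μ, expFun μ (A ^ (n + m)).f x =
      expFun μ (A ^ n).f x * expFun μ (A ^ m).f (((T.toEquiv : Equiv.Perm H) ^ (-n)) x) := by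
  obtain ⟨M, hM, hMi⟩ := h.zpow n
  filter_upwards [hMi.expFun_comp_symm (A ^ m).f] with x hx
  rw [zpow_add, zpow_neg, ← hM]
  exact hx

lemma Implements.totallyDissipative (h : Implements μ A T)
    (hfin : ∀ᵐ x ∂μ, densitySum μ A x < ∞) : TotallyDissipative μ T := by
  set P : Equiv.Perm H := T.toEquiv with hP
  let w : ℤ → H → ℝ := fun n => expFun μ (A ^ n).f
  have hwm : ∀ n, Measurable (w n) := fun n => measurable_expFun _
  let X₀ : Set H := {x | densitySum μ A x < ∞} ∩
    ⋂ n : ℤ, ⋂ m : ℤ, {x | w (n + m) x = w n x * w m ((P ^ (-n)) x)}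
  have hX₀m : MeasurableSet X₀ :=
    (measurableSet_lt (measurable_densitySum A) measurable_const).inter
      (MeasurableSet.iInter fun n => MeasurableSet.iInter fun m => measurableSet_eq_fun (hwm _)
        ((hwm n).mul ((hwm m).comp (h.measurable_zpow _))))
  have hX₀ : ∀ᵐ x ∂μ, x ∈ X₀ := by
    filter_upwards [hfin, ae_all_iff.2 fun n => ae_all_iff.2 fun m => h.ae_cocycle n m]
      with x h1 h2
    exact ⟨h1, Set.mem_iInter.2 fun n => Set.mem_iInter.2 fun m => h2 n m⟩
  -- An invariant conull set on which the sum is finite and all cocycle identities hold exactly, so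
  -- that the translates of `W` are disjoint everywhere.
  let X₁ : Set H := ⋂ n : ℤ, (P ^ n) ⁻¹' X₀
  have hX₁m : MeasurableSet X₁ := MeasurableSet.iInter fun n => h.measurable_zpow n hX₀m
  have hX₁ : ∀ᵐ x ∂μ, x ∈ X₁ := by
    filter_upwards [ae_all_iff.2 fun n => h.ae_zpow hX₀ n] with x hx
    exact Set.mem_iInter.2 hx
  have hX₁inv : ∀ x ∈ X₁, ∀ n : ℤ, (P ^ n) x ∈ X₁ := fun x hx n => by
    refine Set.mem_iInter.2 fun m => ?_
    have := Set.mem_iInter.1 hx (m + n)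
    rwa [Set.mem_preimage, zpow_add, Equiv.Perm.mul_apply] at this
  have hsub : ∀ x ∈ X₁, x ∈ X₀ := fun x hx => by simpa using Set.mem_iInter.1 hx 0
  have hcoc : ∀ x ∈ X₁, ∀ j n : ℤ, w (j + n) x = w j x * w n ((P ^ (-j)) x) := fun x hx j n =>
    Set.mem_iInter.1 (Set.mem_iInter.1 (hsub x hx).2 j) n
  -- The points whose densities `w n`, relative to `w 0 = 1`, are maximal for the last time at `n =
  -- 0`. By the cocycle identity `T^{-j} x ∈ W` exactly when `j` is the last maximizer for `x`; it
  -- is unique, and exists by summability.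
  let W : Set H := X₁ ∩ ⋂ n : ℤ, {x | (n < 0 → w n x ≤ 1) ∧ (0 < n → w n x < 1)}
  have hWm : MeasurableSet W := by
    refine hX₁m.inter (MeasurableSet.iInter fun n => ?_)
    by_cases h1 : n < 0
    · simpa [h1, h1.le, not_lt.2 h1.le] using measurableSet_le (hwm n) measurable_const
    · by_cases h2 : 0 < n
      · simpa [h1, h2] using measurableSet_lt (hwm n) measurable_const
      · simp [h1, h2]
  have hW : ∀ x ∈ X₁, ∀ j : ℤ, (P ^ (-j)) x ∈ W ↔
      ∀ n, (n < j → w n x ≤ w j x) ∧ (j < n → w n x < w j x) := fun x hx j => by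
    have hpos : 0 < w j x := expFun_pos _ _
    have h1 : ∀ n, (w n ((P ^ (-j)) x) ≤ 1 ↔ w (j + n) x ≤ w j x) ∧
        (w n ((P ^ (-j)) x) < 1 ↔ w (j + n) x < w j x) := fun n => by
      rw [hcoc x hx j n]
      exact ⟨(mul_le_iff_le_one_right hpos).symm, (mul_lt_iff_lt_one_right hpos).symm⟩
    constructor
    · intro hxW n
      have h2 := Set.mem_iInter.1 hxW.2 (n - j)
      simp only [Set.mem_ofPred_eq, (h1 _).1, (h1 _).2, add_sub_cancel] at h2
      exact ⟨fun hn => h2.1 (by omega), fun hn => h2.2 (by omega)⟩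
    · intro hn
      refine ⟨hX₁inv x hx _, Set.mem_iInter.2 fun n => ?_⟩
      simp only [Set.mem_ofPred_eq, (h1 _).1, (h1 _).2]
      exact ⟨fun h2 => (hn (j + n)).1 (by omega), fun h2 => (hn (j + n)).2 (by omega)⟩
  have himage : ∀ (n : ℤ) (y : H), y ∈ (P ^ n) '' W ↔ (P ^ (-n)) y ∈ W := fun n y => by
    rw [zpow_neg, Equiv.image_eq_preimage_symm]
    rfl
  refine ⟨W, hWm, ?_, ?_⟩
  · have hdisj : ∀ n m : ℤ, n < m → Disjoint ((P ^ n) '' W) ((P ^ m) '' W) := fun n m hnm => by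
      refine Set.disjoint_left.2 fun y hn hm => ?_
      rw [himage] at hn hm
      have hy : y ∈ X₁ := by
        have := hX₁inv _ hn.1 n
        rwa [← Equiv.Perm.mul_apply, ← zpow_add, add_neg_cancel, zpow_zero] at this
      exact absurd (((hW y hy n).1 hn m).2 hnm) (not_lt.2 (((hW y hy m).1 hm n).1 hnm))
    intro n m hnm
    rcases lt_or_gt_of_ne hnm with h1 | h1
    exacts [hdisj n m h1, (hdisj m n h1).symm]
  · filter_upwards [hX₁] with x hx
    have hsum : Summable fun n => w n x := by
      have h1 := ENNReal.summable_toReal (hsub x hx).1.ne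
      refine h1.congr fun n => ?_
      exact ENNReal.toReal_ofReal (expFun_pos _ _).le
    obtain ⟨j, hj⟩ := exists_last_argmax (fun n => expFun_pos _ x) hsum
    exact Set.mem_iUnion.2 ⟨j, (himage j x).2 ((hW x hx j).2 hj)⟩

lemma toEquiv_pow_apply (T : H ≃ᵐ H) (n : ℕ) (x : H) :
    ((T.toEquiv : Equiv.Perm H) ^ n) x = T^[n] x := by
  rw [Equiv.Perm.coe_pow]
  rfl

/-- A set that never returns has disjoint preimages under all `T^n`, of total measure at most one.
But `μ(T^{-n} s) = ∫_s exp_{f^(n)}`, and these sum to `∫_s ∞`. -/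
lemma Implements.conservative (h : Implements μ A T)
    (hinf : ∀ᵐ x ∂μ, densitySum μ A x = ∞) : Conservative T μ := by
  refine ⟨h.quasiMeasurePreserving, fun s hs hs0 => ?_⟩
  by_contra! hno
  set P : Equiv.Perm H := T.toEquiv with hP
  have hdisj : ∀ n m : ℤ, n < m → Disjoint ((P ^ n) ⁻¹' s) ((P ^ m) ⁻¹' s) := fun n m hnm => by
    refine Set.disjoint_left.2 fun x hn hm => ?_
    obtain ⟨k, hk⟩ := Int.eq_ofNat_of_zero_le (sub_nonneg.2 hnm.le)
    refine hno _ hn k (by omega) ?_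
    rw [← toEquiv_pow_apply, ← hP, ← zpow_natCast, ← hk, ← Equiv.Perm.mul_apply, ← zpow_add,
      sub_add_cancel]
    exact hm
  have hdisj' : Pairwise (Function.onFun Disjoint fun n : ℤ => (P ^ n) ⁻¹' s) := fun n m hnm => by
    rcases lt_or_gt_of_ne hnm with h1 | h1
    exacts [hdisj n m h1, (hdisj m n h1).symm]
  have hle : ∑' n : ℤ, μ ((P ^ n) ⁻¹' s) ≤ 1 := by
    rw [← measure_iUnion hdisj' fun n => h.measurable_zpow n hs]
    exact prob_le_one
  have hμn : ∀ n : ℤ, μ ((P ^ n) ⁻¹' s) = ∫⁻ x in s, ENNReal.ofReal (expFun μ (A ^ n).f x) ∂μ :=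
    fun n => by
      obtain ⟨M, hM, hMi⟩ := h.zpow n
      rw [← withDensity_apply _ hs, ← expMeasure, ← hMi.map_eq, M.map_apply, hP, ← hM]
      rfl
  simp_rw [hμn] at hle
  rw [← lintegral_tsum fun n => (measurable_expFun _).ennreal_ofReal.aemeasurable,
    lintegral_congr_ae (g := fun _ => ∞) (by exact ae_restrict_of_ae hinf), setLIntegral_const,
    ENNReal.top_mul hs0] at hle
  exact absurd hle (by simp)

/-- The wandering set is not null, since its images cover a conull set, and none of its points
returns. -/
lemma Implements.not_conservative_of_totallyDissipative (h : Implements μ A T)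
    (hd : TotallyDissipative μ T) : ¬ Conservative T μ := by
  intro hc
  obtain ⟨W, hWm, hdisj, hun⟩ := hd
  have hW0 : μ W ≠ 0 := fun hW0 => by
    have h1 : ∀ᵐ x ∂μ, x ∉ W := measure_eq_zero_iff_ae_notMem.1 hW0
    have h2 : ∀ᵐ x ∂μ, False := by
      filter_upwards [hun, ae_all_iff.2 fun n => h.ae_zpow h1 n] with x hx hx'
      obtain ⟨n, y, hy, rfl⟩ := Set.mem_iUnion.1 hx
      refine hx' (-n) ?_
      rwa [← Equiv.Perm.mul_apply, ← zpow_add, neg_add_cancel, zpow_zero]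
    exact IsProbabilityMeasure.ne_zero μ (by simpa using h2)
  obtain ⟨x, hx, m, hm, hmx⟩ := hc.exists_mem_iterate_mem' hWm hW0
  have hd : Disjoint (((T.toEquiv : Equiv.Perm H) ^ (m : ℤ)) '' W)
      (((T.toEquiv : Equiv.Perm H) ^ (0 : ℤ)) '' W) := hdisj (by exact_mod_cast hm)
  refine Set.disjoint_left.1 hd ⟨x, hx, ?_⟩ ⟨_, hmx, rfl⟩
  rw [zpow_natCast, toEquiv_pow_apply]
  rfl

end Gaussian

/-! ### Powers of affine operators and the vectors `f^(n)`. -/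

namespace Aff

variable {K : Type*} [NormedAddCommGroup K] [InnerProductSpace ℝ K]

lemma scale_mul (t : ℝ) (A A' : Aff K) : (A * A').scale t = A.scale t * A'.scale t := by
  ext1 <;> simp [scale, mul_def]

lemma scale_one (t : ℝ) : (1 : Aff K).scale t = 1 := by
  ext1 <;> simp [scale, one_def]

/-- `α_t`, as an endomorphism of the affine group. -/
def scaleHom (t : ℝ) : Aff K →* Aff K where
  toFun := scale t
  map_one' := scale_one t
  map_mul' := scale_mul t

lemma scale_zpow_f (t : ℝ) (A : Aff K) (n : ℤ) : ((A.scale t) ^ n).f = t • (A ^ n).f :=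
  congrArg Aff.f (map_zpow (scaleHom t) A n).symm

lemma norm_zpow_neg_f (A : Aff K) (n : ℤ) : ‖(A ^ (-n)).f‖ = ‖(A ^ n).f‖ := by
  rw [zpow_neg, inv_def, norm_neg]
  exact (A ^ n).V.symm.norm_map _

/-- `A` commutes with `A^n`, so `f^(n) - V f^(n) = f - V^n f`: a bound uniform in `n`. -/
lemma norm_zpow_f_sub_le (A : Aff K) (n : ℤ) : ‖(A ^ n).f - A.V (A ^ n).f‖ ≤ 2 * ‖A.f‖ := by
  have h : A ^ n * A = A * A ^ n := ((Commute.refl A).zpow_left n).eq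
  have h1 : (A ^ n).f + (A ^ n).V A.f = A.f + A.V (A ^ n).f := congrArg Aff.f h
  have h2 : (A ^ n).f - A.V (A ^ n).f = A.f - (A ^ n).V A.f := by
    rw [sub_eq_sub_iff_add_eq_add, h1]
  rw [h2, two_mul]
  exact (norm_sub_le _ _).trans_eq (by rw [(A ^ n).V.norm_map])

/-- A sum of values of a function of `‖f^{(n)}‖` over `ℤ` converges as soon as the sum over the
positive integers does. -/
lemma summable_zpow_of_summable_iter {A : Aff K} {φ : ℝ → ℝ}
    (h : Summable fun n : ℕ => φ ‖A.iter (n + 1)‖) : Summable fun n : ℤ => φ ‖(A ^ n).f‖ := by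
  have h0 : Summable fun n : ℕ => φ ‖(A ^ (n : ℤ)).f‖ := by
    refine (summable_nat_add_iff 1).1 ?_
    simpa only [zpow_natCast] using! h
  refine Summable.of_nat_of_neg h0 ?_
  simpa only [norm_zpow_neg_f] using h0

lemma summable_iter_of_summable_zpow {A : Aff K} {φ : ℝ → ℝ}
    (h : Summable fun n : ℤ => φ ‖(A ^ n).f‖) : Summable fun n : ℕ => φ ‖A.iter (n + 1)‖ := by
  have h0 := h.comp_injective (Nat.cast_injective (R := ℤ))
  have h1 := (summable_nat_add_iff 1).2 h0
  simpa only [Function.comp_apply, zpow_natCast] using! h1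

end Aff

section Gaussian

open CameronMartin

variable {H : Type*} [NormedAddCommGroup H] [InnerProductSpace ℝ H] [CompleteSpace H]
  [SecondCountableTopology H] [MeasurableSpace H] [BorelSpace H] {B : PosOperator H}
  {μ : Measure H} [IsProbabilityMeasure μ] {A : Aff (CameronMartin B)}

/-! ### The zero-one law for the sum of the densities -/

/-- A vector orthogonal to the range of `1 - V⁻¹` is fixed by the adjoint `V` of `V⁻¹`. -/
lemma dense_range_sub_symm {K : Type*} [NormedAddCommGroup K] [InnerProductSpace ℝ K]
    [CompleteSpace K] (V : K ≃ₗᵢ[ℝ] K) (hV : ∀ v, V v = v → v = 0) :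
    Dense (Set.range fun g => g - V.symm g) := by
  let L : K →ₗ[ℝ] K := LinearMap.id - V.symm.toLinearEquiv.toLinearMap
  have h : (LinearMap.range L).topologicalClosure = ⊤ := by
    rw [Submodule.topologicalClosure_eq_top_iff, Submodule.eq_bot_iff]
    intro k hk
    have h1 : ∀ g, ⟪g, k - V k⟫ = 0 := fun g => by
      have h2 : ⟪g - V.symm g, k⟫ = 0 := (Submodule.mem_orthogonal _ _).1 hk _ ⟨g, rfl⟩
      have h3 : ⟪V.symm g, k⟫ = ⟪g, V k⟫ := by
        rw [← V.inner_map_map (V.symm g) k, V.apply_symm_apply]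
      rw [inner_sub_right, ← h3, ← inner_sub_left, h2]
    have h4 : k - V k = 0 := by simpa using h1 (k - V k)
    exact hV k (sub_eq_zero.1 h4).symm
  exact Submodule.dense_iff_topologicalClosure_eq_top.2 h

lemma densitySum_le_of_forall_le {x y : H} {C : ℝ}
    (h : ∀ n : ℤ, linearFunctional B μ (A ^ n).f x ≤ linearFunctional B μ (A ^ n).f y + C) :
    densitySum μ A x ≤ ENNReal.ofReal (Real.exp C) * densitySum μ A y := by
  rw [densitySum, densitySum, ← ENNReal.tsum_mul_left]
  refine ENNReal.tsum_le_tsum fun n => ?_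
  rw [← ENNReal.ofReal_mul (Real.exp_pos _).le, expFun, expFun, ← Real.exp_add]
  refine ENNReal.ofReal_le_ofReal (Real.exp_le_exp.2 ?_)
  linarith [h n]

/-- If `V` has no invariant vectors, the sum of the densities is almost everywhere finite or almost
everywhere infinite. -/
lemma densitySum_zero_one (hμ : IsGaussianMeasure B μ) (hV : ∀ v, A.V v = v → v = 0) :
    (∀ᵐ x ∂μ, densitySum μ A x < ∞) ∨ ∀ᵐ x ∂μ, densitySum μ A x = ∞ := by
  have hE : MeasurableSet {x | densitySum μ A x < ∞} :=
    measurableSet_lt (measurable_densitySum A) measurable_const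
  have hinv : ∀ h ∈ Set.range (fun g => g - A.V.symm g), ∀ᵐ x ∂μ,
      x + toH B h ∈ {x | densitySum μ A x < ∞} ↔ x ∈ {x | densitySum μ A x < ∞} := by
    rintro _ ⟨g, rfl⟩
    -- Moving `1 - V⁻¹` to the other side gives `⟪f^(n) - V f^(n), g⟫`, which is bounded
    -- independently of `n`.
    have hb : ∀ n : ℤ, |⟪(A ^ n).f, g - A.V.symm g⟫| ≤ 2 * ‖A.f‖ * ‖g‖ := fun n => by
      have h3 : ⟪(A ^ n).f, A.V.symm g⟫ = ⟪A.V (A ^ n).f, g⟫ := by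
        rw [← A.V.inner_map_map _ (A.V.symm g), A.V.apply_symm_apply]
      rw [inner_sub_right, h3, ← inner_sub_left]
      exact (abs_real_inner_le_norm _ _).trans
        (mul_le_mul_of_nonneg_right (A.norm_zpow_f_sub_le n) (norm_nonneg g))
    filter_upwards [ae_all_iff.2 fun n : ℤ =>
      linearFunctional_add_toH hμ (A ^ n).f (g - A.V.symm g)] with x hx
    have h1 : densitySum μ A (x + toH B (g - A.V.symm g)) ≤ _ * densitySum μ A x :=
      densitySum_le_of_forall_le (C := 2 * ‖A.f‖ * ‖g‖) fun n => by
        rw [hx n]; linarith [(abs_le.1 (hb n)).2]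
    have h2 : densitySum μ A x ≤ _ * densitySum μ A (x + toH B (g - A.V.symm g)) :=
      densitySum_le_of_forall_le (C := 2 * ‖A.f‖ * ‖g‖) fun n => by
        rw [hx n]; linarith [(abs_le.1 (hb n)).1]
    exact ⟨fun h => h2.trans_lt (ENNReal.mul_lt_top ENNReal.ofReal_lt_top h),
      fun h => h1.trans_lt (ENNReal.mul_lt_top ENNReal.ofReal_lt_top h)⟩
  rcases measure_eq_zero_or_compl_of_dense_invariant hμ (dense_range_sub_symm A.V hV) hE hinv
    with h | h
  · right
    filter_upwards [measure_eq_zero_iff_ae_notMem.1 h] with x hx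
    exact not_lt_top_iff.1 hx
  · exact Or.inl h

/-! ### Monotonicity in the scaling parameter -/

lemma lintegral_expFun (hμ : IsGaussianMeasure B μ) (h : CameronMartin B) :
    ∫⁻ x, ENNReal.ofReal (expFun μ h x) ∂μ = 1 := by
  rw [← expMeasure_univ hμ h, expMeasure, withDensity_apply _ MeasurableSet.univ,
    Measure.restrict_univ]

/-- With `s² = u² - t²`, the sum at scale `u`, evaluated at `(t/u) x + (s/u) y`, is `∑ exp_{t
f^(n)}(x) exp_{s f^(n)}(y)`. Integrating over `y` leaves the sum at scale `t`, so it is finite for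
almost all `(x, y)`; the rotation carries this back to `μ`. -/
lemma densitySum_scale_mono (hμ : IsGaussianMeasure B μ) {t u : ℝ} (ht : 0 ≤ t) (htu : t < u)
    (hfin : ∀ᵐ x ∂μ, densitySum μ (A.scale t) x < ∞) :
    ∀ᵐ x ∂μ, densitySum μ (A.scale u) x < ∞ := by
  have hu : 0 < u := ht.trans_lt htu
  set s : ℝ := √(u ^ 2 - t ^ 2) with hs
  have hsq : s ^ 2 = u ^ 2 - t ^ 2 := Real.sq_sqrt (by nlinarith)
  have hcs : (t / u) ^ 2 + (s / u) ^ 2 = 1 := by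
    field_simp
    linarith
  let F : ℤ → H × H → ℝ≥0∞ := fun n p =>
    ENNReal.ofReal (expFun μ (t • (A ^ n).f) p.1) * ENNReal.ofReal (expFun μ (s • (A ^ n).f) p.2)
  have hFm : ∀ n, Measurable (F n) := fun n =>
    ((measurable_expFun _).comp measurable_fst).ennreal_ofReal.mul
      ((measurable_expFun _).comp measurable_snd).ennreal_ofReal
  have hF : ∀ᵐ p ∂(μ.prod μ), ∑' n, F n p < ∞ := by
    rw [Measure.ae_prod_iff_ae_ae (measurableSet_lt (Measurable.tsum hFm) measurable_const)]
    filter_upwards [hfin] with x hx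
    have hFx : ∀ n, Measurable fun y => F n (x, y) := fun n => (hFm n).comp measurable_prodMk_left
    refine ae_lt_top (Measurable.tsum hFx) ?_
    rw [lintegral_tsum fun n => (hFx n).aemeasurable]
    have h1 : ∀ n, ∫⁻ y, F n (x, y) ∂μ = ENNReal.ofReal (expFun μ (t • (A ^ n).f) x) := fun n => by
      simp only [F]
      rw [lintegral_const_mul _ (measurable_expFun _).ennreal_ofReal, lintegral_expFun hμ, mul_one]
    simp_rw [h1]
    simpa only [densitySum, Aff.scale_zpow_f] using hx.ne
  have hrot := map_rotation hμ hcs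
  have hprod : ∀ᵐ p ∂(μ.prod μ), densitySum μ (A.scale u) ((t / u) • p.1 + (s / u) • p.2) < ∞ := by
    have hl : ∀ (c : ℝ) (n : ℤ), ∀ᵐ x ∂μ, linearFunctional B μ (c • (A ^ n).f) x =
      c * linearFunctional B μ (A ^ n).f x := fun c n => linearFunctional_smul c _
    filter_upwards [hF, ae_all_iff.2 fun n : ℤ => linearFunctional_rotation hμ hcs (A ^ n).f,
      measurePreserving_fst.quasiMeasurePreserving.ae (ae_all_iff.2 (hl t)),
      measurePreserving_snd.quasiMeasurePreserving.ae (ae_all_iff.2 (hl s)),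
      hrot.quasiMeasurePreserving.ae (ae_all_iff.2 (hl u))] with p h1 h2 h3 h4 h5
    have h6 : densitySum μ (A.scale u) ((t / u) • p.1 + (s / u) • p.2) = ∑' n, F n p := by
      refine tsum_congr fun n => ?_
      simp only [F]
      rw [← ENNReal.ofReal_mul (expFun_pos _ _).le, Aff.scale_zpow_f, expFun, expFun, expFun,
        h3 n, h4 n, h5 n, h2 n, ← Real.exp_add, norm_smul, norm_smul, norm_smul]
      congr 2
      simp only [mul_pow, Real.norm_eq_abs, sq_abs, hsq]
      field_simp
      ring
    rw [h6]
    exact h1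
  have := (ae_map_iff hrot.measurable.aemeasurable
    (measurableSet_lt (measurable_densitySum (A.scale u)) measurable_const)).2 hprod
  rwa [hrot.map_eq] at this

/-! ### Comparison with the Poincaré series -/

/-- The hypothesis is that the square roots `q n` of the densities have summable integrals. So `∑ q
n` is finite almost everywhere, and `∑ (q n)² ≤ (∑ q n)²`. -/
lemma densitySum_lt_top_of_summable (hμ : IsGaussianMeasure B μ)
    (h : Summable fun n : ℤ => Real.exp (-(‖(A ^ n).f‖ ^ 2 / 8))) :
    ∀ᵐ x ∂μ, densitySum μ A x < ∞ := by
  let q : ℤ → H → ℝ≥0∞ := fun n x => ENNReal.ofReal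
    (Real.exp ((1 / 2) * linearFunctional B μ (A ^ n).f x) * Real.exp (-(‖(A ^ n).f‖ ^ 2 / 4)))
  have hqm : ∀ n, Measurable (q n) := fun n =>
    ((((measurable_linearFunctional (μ := μ) (A ^ n).f).const_mul _).exp).mul_const _).ennreal_ofReal
  have hq : ∀ n, ∫⁻ x, q n x ∂μ = ENNReal.ofReal (Real.exp (-(‖(A ^ n).f‖ ^ 2 / 8))) := fun n => by
    rw [← ofReal_integral_eq_lintegral_ofReal
      ((integrable_exp_linearFunctional hμ _ (1 / 2)).mul_const _)
      (ae_of_all _ fun x => by positivity), integral_mul_const, integral_exp_linearFunctional hμ,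
      ← Real.exp_add]
    ring_nf
  have hsum : ∫⁻ x, ∑' n, q n x ∂μ ≠ ∞ := by
    rw [lintegral_tsum fun n => (hqm n).aemeasurable]
    simp_rw [hq]
    exact h.tsum_ofReal_ne_top
  filter_upwards [ae_lt_top (Measurable.tsum hqm) hsum] with x hx
  have hqq : ∀ n, ENNReal.ofReal (expFun μ (A ^ n).f x) = q n x * q n x := fun n => by
    simp only [q]
    rw [← ENNReal.ofReal_mul (by positivity), ← Real.exp_add, ← Real.exp_add, expFun]
    ring_nf
  calc densitySum μ A x = ∑' n, q n x * q n x := tsum_congr hqq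
    _ ≤ ∑' n, q n x * ∑' m, q m x :=
        ENNReal.tsum_le_tsum fun n => mul_le_mul_right (ENNReal.le_tsum n) _
    _ = (∑' n, q n x) * ∑' m, q m x := ENNReal.tsum_mul_right
    _ < ∞ := ENNReal.mul_lt_top hx hx

lemma measure_linearFunctional_nonneg (hμ : IsGaussianMeasure B μ) (h : CameronMartin B) :
    1 / 2 ≤ μ {x | 0 ≤ linearFunctional B μ h x} := by
  have hm := measurable_linearFunctional (μ := μ) h
  have h1 : ∀ s, MeasurableSet s → μ (linearFunctional B μ h ⁻¹' s) =
      gaussianReal 0 (‖h‖₊ ^ 2) s := fun s hs => by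
    rw [← map_linearFunctional hμ, Measure.map_apply hm hs]
  have h2 : gaussianReal 0 (‖h‖₊ ^ 2) (Set.Iic 0) = gaussianReal 0 (‖h‖₊ ^ 2) (Set.Ici 0) := by
    have h3 := gaussianReal_map_neg (μ := 0) (v := ‖h‖₊ ^ 2)
    rw [neg_zero] at h3
    conv_lhs => rw [← h3]
    rw [Measure.map_apply measurable_neg measurableSet_Iic]
    congr 1
    ext
    simp
  have h4 : (1 : ℝ≥0∞) ≤ μ {x | 0 ≤ linearFunctional B μ h x} +
      μ {x | 0 ≤ linearFunctional B μ h x} := by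
    calc (1 : ℝ≥0∞) = gaussianReal 0 (‖h‖₊ ^ 2) (Set.Iic 0 ∪ Set.Ici 0) := by
          rw [Set.Iic_union_Ici, measure_univ]
      _ ≤ gaussianReal 0 (‖h‖₊ ^ 2) (Set.Iic 0) + gaussianReal 0 (‖h‖₊ ^ 2) (Set.Ici 0) :=
          measure_union_le _ _
      _ = _ := by
          rw [h2, ← h1 _ measurableSet_Ici]
          rfl
  rw [← two_mul] at h4
  rw [ENNReal.div_le_iff (by norm_num) (by norm_num), mul_comm]
  exact h4

/-- The sum is at most some `C` on a set `K C` of measure at least `3/4`, which meets each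
half-space `{l_{f^(n)} ≥ 0}` in measure at least `1/4`. There the density is at least
`e^{-‖f^(n)‖²/2}`, so integrating over `K C` bounds the series by `4C`. -/
lemma summable_of_densitySum_lt_top (hμ : IsGaussianMeasure B μ)
    (h : ∀ᵐ x ∂μ, densitySum μ A x < ∞) :
    Summable fun n : ℤ => Real.exp (-(‖(A ^ n).f‖ ^ 2 / 2)) := by
  let K : ℕ → Set H := fun C => {x | densitySum μ A x ≤ C}
  have hKm : ∀ C, MeasurableSet (K C) := fun C =>
    measurableSet_le (measurable_densitySum A) measurable_const
  have hK : ∃ C, μ (K C)ᶜ ≤ 1 / 4 := by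
    have hmono : Monotone K := fun C C' hC x hx =>
      le_trans (show densitySum μ A x ≤ C from hx) (by exact_mod_cast hC)
    have h1 : μ (⋂ C, (K C)ᶜ) = 0 := by
      refine measure_mono_null (fun x hx => ?_) (show μ {x | ¬ densitySum μ A x < ∞} = 0 from h)
      intro hlt
      obtain ⟨C, hC⟩ := ENNReal.exists_nat_gt hlt.ne
      exact Set.mem_iInter.1 hx C hC.le
    have h2 := tendsto_measure_iInter_atTop (μ := μ) (fun C => (hKm C).compl.nullMeasurableSet)
      (fun C C' hC => Set.compl_subset_compl.2 (hmono hC)) ⟨0, measure_ne_top _ _⟩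
    rw [h1] at h2
    obtain ⟨C, hC⟩ := (h2.eventually (gt_mem_nhds (show (0 : ℝ≥0∞) < 1 / 4 by simp))).exists
    exact ⟨C, hC.le⟩
  obtain ⟨C, hC⟩ := hK
  have hquarter : ∀ n : ℤ, 1 / 4 ≤ μ ({x | 0 ≤ linearFunctional B μ (A ^ n).f x} ∩ K C) := fun n => by
    have h1 := (measure_linearFunctional_nonneg hμ (A ^ n).f).trans
      (measure_le_inter_add_sdiff μ _ (K C))
    have h2 : μ ({x | 0 ≤ linearFunctional B μ (A ^ n).f x} \ K C) ≤ 1 / 4 :=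
      (measure_mono fun x hx => hx.2).trans hC
    have h3 : (1 / 4 : ℝ≥0∞) + 1 / 4 = 1 / 2 := by
      rw [← ENNReal.toReal_eq_toReal_iff' (by simp) (by simp), ENNReal.toReal_add (by simp) (by simp)]
      norm_num
    have h4 := h1.trans (add_le_add_right h2 _)
    rw [← h3] at h4
    exact (ENNReal.add_le_add_iff_right (by simp)).1 h4
  have hterm : ∀ n : ℤ, ENNReal.ofReal (Real.exp (-(‖(A ^ n).f‖ ^ 2 / 2))) * (1 / 4) ≤
      ∫⁻ x in K C, ENNReal.ofReal (expFun μ (A ^ n).f x) ∂μ := fun n => by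
    have hL : MeasurableSet {x | 0 ≤ linearFunctional B μ (A ^ n).f x} :=
      measurableSet_le measurable_const (measurable_linearFunctional _)
    calc _ ≤ ENNReal.ofReal (Real.exp (-(‖(A ^ n).f‖ ^ 2 / 2))) *
          μ ({x | 0 ≤ linearFunctional B μ (A ^ n).f x} ∩ K C) := mul_le_mul_right (hquarter n) _
      _ = ∫⁻ x in {x | 0 ≤ linearFunctional B μ (A ^ n).f x} ∩ K C,
            ENNReal.ofReal (Real.exp (-(‖(A ^ n).f‖ ^ 2 / 2))) ∂μ := (setLIntegral_const _ _).symm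
      _ ≤ ∫⁻ x in {x | 0 ≤ linearFunctional B μ (A ^ n).f x} ∩ K C,
            ENNReal.ofReal (expFun μ (A ^ n).f x) ∂μ := by
          refine setLIntegral_mono' (hL.inter (hKm C)) fun x hx => ?_
          refine ENNReal.ofReal_le_ofReal (Real.exp_le_exp.2 ?_)
          have : 0 ≤ linearFunctional B μ (A ^ n).f x := hx.1
          linarith
      _ ≤ _ := lintegral_mono_set Set.inter_subset_right
  have htsum : (∑' n : ℤ, ENNReal.ofReal (Real.exp (-(‖(A ^ n).f‖ ^ 2 / 2)))) * (1 / 4) ≤ C := by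
    rw [← ENNReal.tsum_mul_right]
    calc _ ≤ ∑' n : ℤ, ∫⁻ x in K C, ENNReal.ofReal (expFun μ (A ^ n).f x) ∂μ :=
          ENNReal.tsum_le_tsum hterm
      _ = ∫⁻ x in K C, densitySum μ A x ∂μ :=
          (lintegral_tsum fun n => (measurable_expFun _).ennreal_ofReal.aemeasurable).symm
      _ ≤ ∫⁻ x in K C, (C : ℝ≥0∞) ∂μ := setLIntegral_mono' (hKm C) fun x hx => hx
      _ ≤ C := by
          rw [setLIntegral_const]
          exact mul_le_of_le_one_right' prob_le_one
  have hne : ∑' n : ℤ, ENNReal.ofReal (Real.exp (-(‖(A ^ n).f‖ ^ 2 / 2))) ≠ ∞ := by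
    intro htop
    rw [htop, ENNReal.top_mul (by simp)] at htsum
    exact absurd htsum (by simp)
  refine (ENNReal.summable_toReal hne).congr fun n => ?_
  exact ENNReal.toReal_ofReal (Real.exp_pos _).le

end Gaussian

/-! ### Existence, uniqueness and bounds of the threshold. -/

section Threshold

variable {K : Type*} [NormedAddCommGroup K] [InnerProductSpace ℝ K]

/-- The series has exponent `α = t²/2`, hence `δ_A ≤ t²/2`. -/
lemma Aff.poincareExponent_le {A : Aff K} {t : ℝ} (ht : 0 < t)
    (h : Summable fun n : ℤ => Real.exp (-(‖((A.scale t) ^ n).f‖ ^ 2 / 2))) :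
    (2 * A.poincareExponent) ^ (1 / 2 : ℝ) ≤ ENNReal.ofReal t := by
  have h1 := Aff.summable_iter_of_summable_zpow (A := A)
    (φ := fun y => Real.exp (-(t ^ 2 / 2) * y ^ 2)) (h.congr fun n => by
      rw [Aff.scale_zpow_f, norm_smul, mul_pow, Real.norm_eq_abs, sq_abs]
      ring_nf)
  have h2 : A.poincareExponent ≤ ENNReal.ofReal (t ^ 2 / 2) :=
    sInf_le ⟨t ^ 2 / 2, ⟨by positivity, h1⟩, rfl⟩
  have h3 : 2 * A.poincareExponent ≤ ENNReal.ofReal t ^ (2 : ℝ) := by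
    calc 2 * A.poincareExponent ≤ ENNReal.ofReal 2 * ENNReal.ofReal (t ^ 2 / 2) := by
          rw [ENNReal.ofReal_ofNat]
          gcongr
      _ = ENNReal.ofReal t ^ (2 : ℝ) := by
          rw [← ENNReal.ofReal_mul (by norm_num), ENNReal.rpow_ofNat, ← ENNReal.ofReal_pow ht.le]
          ring_nf
  calc (2 * A.poincareExponent) ^ (1 / 2 : ℝ) ≤ (ENNReal.ofReal t ^ (2 : ℝ)) ^ (1 / 2 : ℝ) := by
        gcongr
    _ = ENNReal.ofReal t := by
        rw [← ENNReal.rpow_mul]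
        norm_num

/-- The hypothesis amounts to `δ_A < t²/8`; comparison with a convergent exponent `α < t²/8`
finishes. -/
lemma Aff.summable_of_poincareExponent_lt {A : Aff K} {t : ℝ} (ht : 0 < t)
    (h : 2 * (2 * A.poincareExponent) ^ (1 / 2 : ℝ) < ENNReal.ofReal t) :
    Summable fun n : ℤ => Real.exp (-(‖((A.scale t) ^ n).f‖ ^ 2 / 8)) := by
  have h1 : A.poincareExponent < ENNReal.ofReal (t ^ 2 / 8) := by
    by_contra! hle
    refine absurd h (not_lt.2 ?_)
    have h2 : ENNReal.ofReal (t / 2) ^ (2 : ℝ) ≤ 2 * A.poincareExponent := by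
      calc ENNReal.ofReal (t / 2) ^ (2 : ℝ) = ENNReal.ofReal 2 * ENNReal.ofReal (t ^ 2 / 8) := by
            rw [← ENNReal.ofReal_mul (by norm_num), ENNReal.rpow_ofNat,
              ← ENNReal.ofReal_pow (by positivity)]
            ring_nf
        _ ≤ _ := by
            rw [ENNReal.ofReal_ofNat]
            gcongr
    have h3 : ENNReal.ofReal (t / 2) ≤ (2 * A.poincareExponent) ^ (1 / 2 : ℝ) := by
      calc ENNReal.ofReal (t / 2) = (ENNReal.ofReal (t / 2) ^ (2 : ℝ)) ^ (1 / 2 : ℝ) := by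
            rw [← ENNReal.rpow_mul]
            norm_num
        _ ≤ _ := by gcongr
    calc ENNReal.ofReal t = ENNReal.ofReal 2 * ENNReal.ofReal (t / 2) := by
          rw [← ENNReal.ofReal_mul (by norm_num)]
          ring_nf
      _ ≤ _ := by
          rw [ENNReal.ofReal_ofNat]
          gcongr
  obtain ⟨_, ⟨α, ⟨hα, hsum⟩, rfl⟩, hαt⟩ := sInf_lt_iff.1 h1
  have hαt' : α ≤ t ^ 2 / 8 := (ENNReal.ofReal_le_ofReal_iff (by positivity)).1 hαt.le
  have h2 := Aff.summable_zpow_of_summable_iter (A := A) (φ := fun y => Real.exp (-α * y ^ 2)) hsum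
  refine Summable.of_nonneg_of_le (fun n => (Real.exp_pos _).le) (fun n => ?_) h2
  refine Real.exp_le_exp.2 ?_
  rw [Aff.scale_zpow_f, norm_smul, mul_pow, Real.norm_eq_abs, sq_abs]
  nlinarith [sq_nonneg ‖(A ^ n).f‖]

variable {H : Type*} [NormedAddCommGroup H] [InnerProductSpace ℝ H] [CompleteSpace H]
  [SecondCountableTopology H] [MeasurableSpace H] [BorelSpace H] {B : PosOperator H}
  {μ : Measure H} [IsProbabilityMeasure μ] {A : Aff (CameronMartin B)}

/-- A real `t` strictly between two thresholds would be both conservative and totally dissipative.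
-/
lemma IsDissipativityThreshold.le (hμ : IsGaussianMeasure B μ) [Nontrivial H] {τ τ' : ℝ≥0∞}
    (h : IsDissipativityThreshold μ A τ) (h' : IsDissipativityThreshold μ A τ') : τ ≤ τ' := by
  by_contra! hlt
  obtain ⟨t, ht0, h1, h2⟩ := ENNReal.lt_iff_exists_real_btwn.1 hlt
  have ht : 0 < t := ENNReal.ofReal_pos.1 (h1.trans_le' zero_le)
  exact (implements_gaussianTransformation hμ (A.scale t)).not_conservative_of_totallyDissipative
    ((h' t ht).2 h1) ((h t ht).1 h2)

lemma exists_isDissipativityThreshold (hμ : IsGaussianMeasure B μ) [Nontrivial H]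
    (hV : ∀ v : CameronMartin B, A.V v = v → v = 0) :
    ∃ τ : ℝ≥0∞, IsDissipativityThreshold μ A τ := by
  -- The infimum of the scales at which the sum is finite, equal to `∞` if there are none. Below it
  -- the zero-one law applies, above it monotonicity.
  refine ⟨sInf (ENNReal.ofReal '' {t | 0 < t ∧ ∀ᵐ x ∂μ, densitySum μ (A.scale t) x < ∞}),
    fun t ht => ⟨fun hlt => ?_, fun hlt => ?_⟩⟩
  · rcases densitySum_zero_one (A := A.scale t) hμ hV with h | h
    · exact absurd hlt (not_lt.2 (sInf_le ⟨t, ⟨ht, h⟩, rfl⟩))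
    · exact (implements_gaussianTransformation hμ _).conservative h
  · obtain ⟨_, ⟨s, ⟨hs, hfin⟩, rfl⟩, hst⟩ := sInf_lt_iff.1 hlt
    exact (implements_gaussianTransformation hμ _).totallyDissipative
      (densitySum_scale_mono hμ hs.le ((ENNReal.ofReal_lt_ofReal_iff ht).1 hst) hfin)

lemma IsDissipativityThreshold.bounds (hμ : IsGaussianMeasure B μ) [Nontrivial H]
    (hV : ∀ v : CameronMartin B, A.V v = v → v = 0) {τ : ℝ≥0∞}
    (h : IsDissipativityThreshold μ A τ) :
    (2 * A.poincareExponent) ^ (1 / 2 : ℝ) ≤ τ ∧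
      τ ≤ 2 * (2 * A.poincareExponent) ^ (1 / 2 : ℝ) := by
  constructor
  · by_contra! hlt
    obtain ⟨t, ht0, h1, h2⟩ := ENNReal.lt_iff_exists_real_btwn.1 hlt
    have ht : 0 < t := ENNReal.ofReal_pos.1 (h1.trans_le' zero_le)
    have hT := implements_gaussianTransformation hμ (A.scale t)
    rcases densitySum_zero_one (A := A.scale t) hμ hV with h3 | h3
    · exact absurd h2 (not_lt.2
        (Aff.poincareExponent_le ht (summable_of_densitySum_lt_top hμ h3)))
    · exact hT.not_conservative_of_totallyDissipative ((h t ht).2 h1) (hT.conservative h3)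
  · by_contra! hlt
    obtain ⟨t, ht0, h1, h2⟩ := ENNReal.lt_iff_exists_real_btwn.1 hlt
    have ht : 0 < t := ENNReal.ofReal_pos.1 (h1.trans_le' zero_le)
    have hT := implements_gaussianTransformation hμ (A.scale t)
    exact hT.not_conservative_of_totallyDissipative (hT.totallyDissipative
      (densitySum_lt_top_of_summable hμ (Aff.summable_of_poincareExponent_lt ht h1)))
      ((h t ht).1 h2)

end Threshold

end NonsingularGaussian

end

theorem proposition3p14 {H : Type*} [NormedAddCommGroup H] [InnerProductSpace ℝ H]
    [CompleteSpace H] [TopologicalSpace.SeparableSpace H] [MeasurableSpace H] [BorelSpace H]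
    (hdim : ¬ FiniteDimensional ℝ H)
    (B : PosOperator H) (μ : Measure H) [IsProbabilityMeasure μ] (hμ : IsGaussianMeasure B μ)
    (A : Aff (CameronMartin B)) (hV : ∀ v : CameronMartin B, A.V v = v → v = 0) :
    (∃! τ : ℝ≥0∞, IsDissipativityThreshold μ A τ) ∧
    ∀ τ : ℝ≥0∞, IsDissipativityThreshold μ A τ →
      (2 * A.poincareExponent) ^ (1 / 2 : ℝ) ≤ τ ∧
      τ ≤ 2 * (2 * A.poincareExponent) ^ (1 / 2 : ℝ) := by
  have : SecondCountableTopology H := UniformSpace.secondCountable_of_separable H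
  -- Nontriviality makes `μ` atomless, which the construction of the Borel automorphisms requires.
  have : Nontrivial H := by
    by_contra h
    rw [not_nontrivial_iff_subsingleton] at h
    exact hdim inferInstance
  obtain ⟨τ, hτ⟩ := exists_isDissipativityThreshold hμ hV
  exact ⟨⟨τ, hτ, fun τ' hτ' => le_antisymm (hτ'.le hμ hτ) (hτ.le hμ hτ')⟩,
    fun τ' hτ' => hτ'.bounds hμ hV⟩
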